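/- Let $H\in(1/2,1)$, let $\sigma_H^2=\frac{1}{\Gamma(2H+1)\sin(\pi H)}$ and $\sigma_{\rm ou}^2=\frac12\Gamma(2H+1)\sigma_H^2$ with $\sigma_{\rm ou}>0$. Let $W^H=(W^H_t)_{t\in\mathbb R}$ be a fractional Brownian motion with Hurst index $H$, that is, a zero-mean Gaussian process with almost surely continuous paths and covariance $$\mathbb E[W^H_tW^H_s]=\frac{\sigma_H^2}{2}\big(|t|^{2H}+|s|^{2H}-|t-s|^{2H}\big),$$ and for $\varepsilon>0$ let $$Z^\varepsilon_t=\varepsilon^{-H}W^H_t-\varepsilon^{-1-H}\int_{-\infty}^t e^{-\frac{t-s}{\varepsilon}}W^H_s\,ds$$ be the $\varepsilon$-scaled fractional Ornstein–Uhlenbeck process. Let $F:\mathbb R\to\mathbb R$ be smooth, bounded, and with bounded derivatives of all orders. With $p(z)=e^{-z^2/2}/\sqrt{2\pi}$ and the Hermite polynomials $H_k(z)=(-1)^k e^{z^2/2}\frac{d^k}{dz^k}e^{-z^2/2}$, put $$\langle F^2\rangle=\int_{\mathbb R}F(\sigma_{\rm ou}z)^2p(z)\,dz,\qquad C_k=\int_{\mathbb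 R}H_k(z)F(\sigma_{\rm ou}z)^2p(z)\,dz,\quad k\ge 0 .$$ Suppose that there is some $\alpha>2$ with $\sum_{k=0}^\infty \frac{\alpha^kC_k^2}{k!}<\infty$. Then for every $T>0$ there is a constant $K$, depending only on $H$, $F$ and $T$, such that for every $\varepsilon>0$ the process $$I^\varepsilon_t=\int_0^t\big(F(Z^\varepsilon_s)^2-\langle F^2\rangle\big)\,ds$$ satisfies $$\sup_{t\in[0,T]}\mathbb E\big[(I^\varepsilon_t)^4\big]\le K\,\varepsilon^{4-4H}.$$ Here, almost surely, the integrals defining $Z^\varepsilon_t$ ($t\in\mathbb R$) and $I^\varepsilon_t$ ($t\in[0,T]$) converge absolutely, and $(I_t^\varepsilon)^4$ is integrable. -/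

import Mathlib

open MeasureTheory ProbabilityTheory

namespace FracOU

/-- The variance constant `σ_H² = 1 / (Γ(2H+1) sin(πH))` of the fractional Brownian motion given by
the Mandelbrot–Van Ness moving average of a standard Brownian motion. -/
noncomputable def sigmaHSq (H : ℝ) : ℝ :=
  1 / (Real.Gamma (2 * H + 1) * Real.sin (Real.pi * H))

/-- The stationary standard deviation of the fractional Ornstein–Uhlenbeck process:
`σ_ou² = Γ(2H+1) σ_H² / 2`. -/
noncomputable def sigmaOU (H : ℝ) : ℝ :=
  Real.sqrt (Real.Gamma (2 * H + 1) * sigmaHSq H / 2)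

/-- `W` is a fractional Brownian motion on `ℝ` with Hurst index `H` and variance constant `σ_H²`:
a zero-mean Gaussian process, with the covariance
`E[W_t W_s] = (σ_H² / 2) (|t|^{2H} + |s|^{2H} - |t - s|^{2H})` and almost surely continuous
paths. -/
structure IsFBM {Ω : Type*} [MeasurableSpace Ω] (H : ℝ) (W : ℝ → Ω → ℝ) (P : Measure Ω) :
    Prop where
  gaussian : IsGaussianProcess W P
  mean_zero : ∀ t, ∫ ω, W t ω ∂P = 0
  covariance : ∀ t s, ∫ ω, W t ω * W s ω ∂P =
    sigmaHSq H / 2 * (|t| ^ (2 * H) + |s| ^ (2 * H) - |t - s| ^ (2 * H))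
  continuous_paths : ∀ᵐ ω ∂P, Continuous fun t => W t ω

/-- The `ε`-scaled fractional Ornstein–Uhlenbeck process driven by `W`, defined pathwise by
`Z_t = ε^{-H} W_t - ε^{-1-H} ∫_{-∞}^t e^{-(t-s)/ε} W_s ds`. -/
noncomputable def fOU {Ω : Type*} (H ε : ℝ) (W : ℝ → Ω → ℝ) (t : ℝ) (ω : Ω) : ℝ :=
  ε ^ (-H) * W t ω -
    ε ^ (-1 - H) * ∫ s in Set.Iic t, Real.exp (-(t - s) / ε) * W s ω

/-- `⟨F²⟩ = ∫ F(σ_ou z)² p(z) dz`, with `p` the standard normal density. -/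
noncomputable def meanSq (H : ℝ) (F : ℝ → ℝ) : ℝ :=
  ∫ z, F (sigmaOU H * z) ^ 2 ∂(gaussianReal 0 1)

/-- The Hermite coefficient `C_k = ∫ H_k(z) F(σ_ou z)² p(z) dz`, with the probabilists'
Hermite polynomials `H_k(z) = (-1)^k e^{z²/2} (d/dz)^k e^{-z²/2}`. -/
noncomputable def hermiteCoeff (H : ℝ) (F : ℝ → ℝ) (k : ℕ) : ℝ :=
  ∫ z, Polynomial.aeval z (Polynomial.hermite k) * F (sigmaOU H * z) ^ 2 ∂(gaussianReal 0 1)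

/-- `I_t = ∫_0^t (F(Z_s)² - ⟨F²⟩) ds` for the `ε`-scaled process `Z`. -/
noncomputable def fluctuation {Ω : Type*} (H ε : ℝ) (F : ℝ → ℝ) (W : ℝ → Ω → ℝ)
    (t : ℝ) (ω : Ω) : ℝ :=
  ∫ s in (0 : ℝ)..t, (F (fOU H ε W s ω) ^ 2 - meanSq H F)

end FracOU

/-! The bound rests on Gaussian concentration and on the decay of the covariance of $Z^\varepsilon$;
no Hermite expansion enters.

Let $f$ be a $C^1$ function of a centered Gaussian vector $X$, and $Y$ an independent copy. Rotating
$(X,Y)$ by an angle $\theta\in[0,\pi/2]$ moves $f(X)$ to $f(Y)$, with derivative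
$f'(X_\theta)Y_\theta$. The rotated pair has the law of $(X,Y)$, so given $X_\theta$ this derivative
is a centered normal variable. If its variance is at most $L$, then $E(f(Y)-f(X))^4\le cL^2$, and
for bounded centered $f$ the left side dominates $Ef(X)^4$ (`integral_pow_four_le_of_isGaussian`).

Take $f=\sum_i w\,g(z_i)$ with $g=F^2-\langle F^2\rangle$, a Riemann sum of $I^\varepsilon_t$ with
step $w$. Since $g'$ is bounded, $L$ is a multiple of $\sum_{i,j}w^2|E Z_iZ_j|$. Writing
$Z^\varepsilon$ as an exponential average of increments of $W$ turns $E Z_tZ_s$ into an average of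
mixed second differences of $|x|^{2H}$, whence $|E Z_tZ_s|\le C\varepsilon^{2-2H}|t-s|^{2H-2}$
(`abs_covariance_fOU_le`). As $2H-2>-1$ the kernel is summable across the diagonal, so
$L=O(\varepsilon^{2-2H})+O(1/n)$ (`sum_abs_covariance_le`). Letting $n\to\infty$ removes the second
term, and squaring $L$ gives $\varepsilon^{4-4H}$. -/

namespace FracOU

/-! ### Fourth moment concentration for Gaussian measures. -/

section GaussianConcentration

/-- The fourth moment of the standard normal law. -/
noncomputable def gaussianFourthMoment : ℝ := ∫ z, z ^ 4 ∂(gaussianReal 0 1)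

lemma gaussianFourthMoment_nonneg : 0 ≤ gaussianFourthMoment :=
  integral_nonneg fun z => by positivity

lemma gaussianReal_eq_map_std {v : ℝ} (hv : 0 ≤ v) :
    gaussianReal 0 v.toNNReal = (gaussianReal 0 1).map (fun z => Real.sqrt v * z) := by
  rw [gaussianReal_map_const_mul]
  congr 1
  · simp
  · ext
    simp [hv]

lemma integral_pow_four_gaussianReal {v : ℝ} (hv : 0 ≤ v) :
    ∫ z, z ^ 4 ∂(gaussianReal 0 v.toNNReal) = v ^ 2 * gaussianFourthMoment := by
  rw [gaussianReal_eq_map_std hv, integral_map (by fun_prop) (by fun_prop), gaussianFourthMoment,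
    ← integral_const_mul]
  congr 1 with z
  rw [mul_pow, show Real.sqrt v ^ 4 = (Real.sqrt v ^ 2) ^ 2 by ring, Real.sq_sqrt hv]

/-- Jensen's inequality for $y\mapsto y^4$ and the normalized measure on $(0,a]$; multiplying by
$a^4$ clears the averages. -/
lemma pow_four_intervalIntegral_le {h : ℝ → ℝ} (hh : Continuous h) {a : ℝ} (ha : 0 < a) :
    (∫ x in (0 : ℝ)..a, h x) ^ 4 ≤ a ^ 3 * ∫ x in (0 : ℝ)..a, h x ^ 4 := by
  have hI : ∀ {k : ℝ → ℝ}, Continuous k → IntegrableOn k (Set.Ioc 0 a) := fun hk =>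
    (hk.integrableOn_Icc).mono_set Set.Ioc_subset_Icc_self
  have key := ConvexOn.map_set_average_le (μ := (volume : Measure ℝ)) (t := Set.Ioc 0 a) (f := h)
    (g := fun y : ℝ => y ^ 4) (s := Set.univ)
    (Even.convexOn_pow (by decide)) (by fun_prop) isClosed_univ (by simp [ha]) (by simp)
    (by simp) (hI hh) (hI (hh.pow 4))
  simp only [setAverage_eq, smul_eq_mul, Measure.real, Real.volume_Ioc, sub_zero,
    ENNReal.toReal_ofReal ha.le] at key
  rw [intervalIntegral.integral_of_le ha.le, intervalIntegral.integral_of_le ha.le]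
  have h4 := mul_le_mul_of_nonneg_left key (by positivity : 0 ≤ a ^ 4)
  have e1 : ∀ x : ℝ, a ^ 4 * (a⁻¹ * x) ^ 4 = x ^ 4 := fun x => by field_simp
  have e2 : ∀ x : ℝ, a ^ 4 * (a⁻¹ * x) = a ^ 3 * x := fun x => by field_simp
  rwa [e1, e2] at h4

variable {E : Type*} [NormedAddCommGroup E] [NormedSpace ℝ E] [MeasurableSpace E] [BorelSpace E]
  [SecondCountableTopology E] [CompleteSpace E]

-- The $\theta$-derivative of the first component of the rotated pair is its second component, and
-- the first component runs from `p.1` to `p.2`. The fundamental theorem of calculus and Jensen then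
-- apply.
omit [MeasurableSpace E] [BorelSpace E] [SecondCountableTopology E] [CompleteSpace E] in
lemma sub_pow_four_le_integral_rotation {f : E → ℝ} {f' : E → E →L[ℝ] ℝ}
    (hf : ∀ x, HasFDerivAt f (f' x) x) (hf' : Continuous f') (p : E × E) :
    (f p.2 - f p.1) ^ 4 ≤ (Real.pi / 2) ^ 3 * ∫ θ in (0 : ℝ)..(Real.pi / 2),
      (f' (ContinuousLinearMap.rotation θ p).1 (ContinuousLinearMap.rotation θ p).2) ^ 4 := by
  have hc : Continuous fun θ : ℝ => f' (ContinuousLinearMap.rotation θ p).1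
      (ContinuousLinearMap.rotation θ p).2 := by
    simp only [ContinuousLinearMap.rotation_apply]
    fun_prop
  have hd : ∀ θ : ℝ, HasDerivAt (fun θ => f (ContinuousLinearMap.rotation θ p).1)
      (f' (ContinuousLinearMap.rotation θ p).1 (ContinuousLinearMap.rotation θ p).2) θ := by
    intro θ
    have h1 : HasDerivAt (fun θ : ℝ => (ContinuousLinearMap.rotation θ p).1)
        (ContinuousLinearMap.rotation θ p).2 θ := by
      simp only [ContinuousLinearMap.rotation_apply]
      exact ((Real.hasDerivAt_cos θ).smul_const p.1).add ((Real.hasDerivAt_sin θ).smul_const p.2)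
    exact (hf _).comp_hasDerivAt θ h1
  have hFTC := intervalIntegral.integral_eq_sub_of_hasDerivAt (a := 0) (b := Real.pi / 2)
    (fun θ _ => hd θ) (hc.intervalIntegrable _ _)
  have : f p.2 - f p.1 = ∫ θ in (0 : ℝ)..(Real.pi / 2),
      f' (ContinuousLinearMap.rotation θ p).1 (ContinuousLinearMap.rotation θ p).2 := by
    rw [hFTC]
    simp [ContinuousLinearMap.rotation_apply]
  rw [this]
  exact pow_four_intervalIntegral_le hc (by positivity)

omit [SecondCountableTopology E] [CompleteSpace E] in
lemma integrable_dual_pow (μ : Measure E) [IsGaussian μ] (ℓ : E →L[ℝ] ℝ) (n : ℕ) :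
    Integrable (fun y => ℓ y ^ n) μ := by
  have h := (IsGaussian.memLp_dual μ ℓ n (by simp)).integrable_norm_pow'
  refine h.mono' (by fun_prop) (ae_of_all _ fun z => ?_)
  simp

/-- Under $\mu$ the functional `ℓ` is centered normal, so scaling makes its fourth moment a fixed
multiple of its squared variance; the numerical value of that multiple is never needed. -/
lemma integral_dual_pow_four_le (μ : Measure E) [IsGaussian μ] (hμ : ∫ x, x ∂μ = 0)
    (ℓ : E →L[ℝ] ℝ) {L : ℝ} (hL : ∫ y, ℓ y ^ 2 ∂μ ≤ L) :
    ∫ y, ℓ y ^ 4 ∂μ ≤ L ^ 2 * gaussianFourthMoment := by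
  have h0 : ∫ y, ℓ y ∂μ = 0 := by rw [IsGaussian.integral_dual, hμ, map_zero]
  have hv : Var[ℓ; μ] = ∫ y, ℓ y ^ 2 ∂μ := by
    rw [variance_eq_integral (by fun_prop), h0]
    simp
  have hv0 : 0 ≤ Var[ℓ; μ] := variance_nonneg _ _
  have h1 : ∫ y, ℓ y ^ 4 ∂μ = ∫ z, z ^ 4 ∂(μ.map ℓ) := by
    rw [integral_map (by fun_prop) (by fun_prop)]
  rw [h1, IsGaussian.map_eq_gaussianReal, h0, integral_pow_four_gaussianReal hv0, hv]
  rw [hv] at hv0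
  gcongr
  exact gaussianFourthMoment_nonneg

/-- A fourth moment Poincaré inequality for centered Gaussian measures, in symmetrized form. -/
theorem lintegral_add_pow_four_le (μ : Measure E) [IsGaussian μ] (hμ : ∫ x, x ∂μ = 0)
    {f : E → ℝ} {f' : E → E →L[ℝ] ℝ} (hf : ∀ x, HasFDerivAt f (f' x) x) (hf' : Continuous f')
    {L : ℝ} (hL : ∀ x, ∫ y, (f' x y) ^ 2 ∂μ ≤ L) :
    ∫⁻ p, ENNReal.ofReal ((f p.2 - f p.1) ^ 4) ∂(μ.prod μ) ≤
      ENNReal.ofReal ((Real.pi / 2) ^ 4 * (L ^ 2 * gaussianFourthMoment)) := by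
  have hcont : Continuous fun q : E × E => f' q.1 q.2 := by fun_prop
  have hcont2 : Continuous fun q : (E × E) × ℝ => f' (ContinuousLinearMap.rotation q.2 q.1).1
      (ContinuousLinearMap.rotation q.2 q.1).2 := by
    simp only [ContinuousLinearMap.rotation_apply]
    fun_prop
  have hin : ∀ θ : ℝ, ∫⁻ p, ENNReal.ofReal ((f' (ContinuousLinearMap.rotation θ p).1
      (ContinuousLinearMap.rotation θ p).2) ^ 4) ∂(μ.prod μ) ≤
      ENNReal.ofReal (L ^ 2 * gaussianFourthMoment) := by
    intro θ
    -- Rotation invariance of $\mu\otimes\mu$ removes $\theta$; Tonelli then freezes `x`, leaving a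
    -- fixed functional `f' x` of `y`.
    have h1 := lintegral_map (μ := μ.prod μ) (g := ContinuousLinearMap.rotation θ)
      (f := fun q : E × E => ENNReal.ofReal ((f' q.1 q.2) ^ 4)) (by fun_prop) (by fun_prop)
    rw [← h1, IsGaussian.map_rotation_eq_self (by simpa using hμ),
      lintegral_prod _ (by fun_prop)]
    calc ∫⁻ x, ∫⁻ y, ENNReal.ofReal ((f' x y) ^ 4) ∂μ ∂μ
        ≤ ∫⁻ _, ENNReal.ofReal (L ^ 2 * gaussianFourthMoment) ∂μ := by
          refine lintegral_mono fun x => ?_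
          rw [← ofReal_integral_eq_lintegral_ofReal (integrable_dual_pow μ (f' x) 4)
            (ae_of_all _ fun y => by positivity)]
          exact ENNReal.ofReal_le_ofReal (integral_dual_pow_four_le μ hμ (f' x) (hL x))
      _ = _ := by simp
  calc ∫⁻ p, ENNReal.ofReal ((f p.2 - f p.1) ^ 4) ∂(μ.prod μ)
      ≤ ∫⁻ p, (ENNReal.ofReal ((Real.pi / 2) ^ 3) * ∫⁻ θ in Set.Ioc 0 (Real.pi / 2),
          ENNReal.ofReal ((f' (ContinuousLinearMap.rotation θ p).1
            (ContinuousLinearMap.rotation θ p).2) ^ 4)) ∂(μ.prod μ) := by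
        refine lintegral_mono fun p => ?_
        refine (ENNReal.ofReal_le_ofReal (sub_pow_four_le_integral_rotation hf hf' p)).trans ?_
        rw [ENNReal.ofReal_mul (by positivity),
          intervalIntegral.integral_of_le (by positivity), ofReal_integral_eq_lintegral_ofReal]
        · have : Continuous fun θ : ℝ => (f' (ContinuousLinearMap.rotation θ p).1
            (ContinuousLinearMap.rotation θ p).2) ^ 4 := by
            exact (hcont2.comp (by fun_prop : Continuous fun θ : ℝ => (p, θ))).pow 4
          exact this.integrableOn_Icc.mono_set Set.Ioc_subset_Icc_self
        · exact ae_of_all _ fun y => by positivity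
    _ = ENNReal.ofReal ((Real.pi / 2) ^ 3) * ∫⁻ θ in Set.Ioc 0 (Real.pi / 2), ∫⁻ p,
          ENNReal.ofReal ((f' (ContinuousLinearMap.rotation θ p).1
            (ContinuousLinearMap.rotation θ p).2) ^ 4) ∂(μ.prod μ) := by
        rw [lintegral_const_mul', lintegral_lintegral_swap]
        · exact (ENNReal.measurable_ofReal.comp (hcont2.pow 4).measurable).aemeasurable
        · exact ENNReal.ofReal_ne_top
    _ ≤ ENNReal.ofReal ((Real.pi / 2) ^ 3) * ∫⁻ _ in Set.Ioc 0 (Real.pi / 2),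
          ENNReal.ofReal (L ^ 2 * gaussianFourthMoment) := by
        gcongr with θ
        exact hin θ
    _ = _ := by
        rw [setLIntegral_const, Real.volume_Ioc, sub_zero, mul_comm (ENNReal.ofReal (L ^ 2 * _)),
          ← mul_assoc, ← ENNReal.ofReal_mul (by positivity), ← ENNReal.ofReal_mul (by positivity)]
        congr 1

/-- A fourth moment Poincaré inequality for bounded functions of a centered Gaussian vector. -/
theorem integral_pow_four_le_of_isGaussian (μ : Measure E) [IsGaussian μ] (hμ : ∫ x, x ∂μ = 0)
    {f : E → ℝ} {f' : E → E →L[ℝ] ℝ} (hf : ∀ x, HasFDerivAt f (f' x) x) (hf' : Continuous f')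
    {L : ℝ} (hL : ∀ x, ∫ y, (f' x y) ^ 2 ∂μ ≤ L) {B : ℝ} (hB : ∀ x, |f x| ≤ B)
    (hf0 : ∫ x, f x ∂μ = 0) :
    ∫ x, f x ^ 4 ∂μ ≤ (Real.pi / 2) ^ 4 * (L ^ 2 * gaussianFourthMoment) := by
  have hcont : Continuous f := continuous_iff_continuousAt.2 fun x => (hf x).continuousAt
  have hint : ∀ n : ℕ, Integrable (fun x => f x ^ n) μ := fun n =>
    Integrable.of_bound (by fun_prop) (B ^ n) (ae_of_all _ fun x => by
      rw [norm_pow, Real.norm_eq_abs]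
      exact pow_le_pow_left₀ (abs_nonneg _) (hB x) n)
  have hprod : ∀ m n : ℕ, Integrable (fun p : E × E => f p.1 ^ m * f p.2 ^ n) (μ.prod μ) :=
    fun m n => (hint m).mul_prod (hint n)
  have hprodI : ∀ m n : ℕ, ∫ p : E × E, f p.1 ^ m * f p.2 ^ n ∂(μ.prod μ) =
      (∫ x, f x ^ m ∂μ) * ∫ x, f x ^ n ∂μ := fun m n =>
    integral_prod_mul (fun x => f x ^ m) (fun x => f x ^ n)
  -- The zeroth and first powers are kept so that each term has the form handled by `hprod`. The two
  -- odd terms contain the factor $\int f=0$.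
  have hexp : ∀ p : E × E, (f p.2 - f p.1) ^ 4 = f p.1 ^ 4 * f p.2 ^ 0 + f p.1 ^ 0 * f p.2 ^ 4
      + 6 * (f p.1 ^ 2 * f p.2 ^ 2) + -4 * (f p.1 ^ 3 * f p.2 ^ 1)
      + -4 * (f p.1 ^ 1 * f p.2 ^ 3) := fun p => by ring
  have hi1 := (hprod 4 0).fun_add (hprod 0 4)
  have hi2 := hi1.fun_add ((hprod 2 2).const_mul 6)
  have hi3 := hi2.fun_add ((hprod 3 1).const_mul (-4))
  have hi4 := hi3.fun_add ((hprod 1 3).const_mul (-4))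
  have hI : Integrable (fun p : E × E => (f p.2 - f p.1) ^ 4) (μ.prod μ) := by
    simp only [hexp]; exact hi4
  have h1 : ∫ p : E × E, (f p.2 - f p.1) ^ 4 ∂(μ.prod μ) =
      2 * ∫ x, f x ^ 4 ∂μ + 6 * (∫ x, f x ^ 2 ∂μ) ^ 2 := by
    simp only [hexp]
    rw [integral_add hi3 ((hprod 1 3).const_mul (-4)), integral_add hi2 ((hprod 3 1).const_mul (-4)),
      integral_add hi1 ((hprod 2 2).const_mul 6), integral_add (hprod 4 0) (hprod 0 4)]
    simp only [integral_const_mul, hprodI]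
    simp [hf0]
    ring
  have h2 := lintegral_add_pow_four_le μ hμ hf hf' hL
  rw [← ofReal_integral_eq_lintegral_ofReal hI (ae_of_all _ fun y => by positivity),
    ENNReal.ofReal_le_ofReal_iff (mul_nonneg (by positivity)
      (mul_nonneg (by positivity) gaussianFourthMoment_nonneg)), h1] at h2
  have h3 : 0 ≤ ∫ x, f x ^ 4 ∂μ := integral_nonneg fun x => by positivity
  nlinarith [sq_nonneg (∫ x, f x ^ 2 ∂μ)]

end GaussianConcentration

/-! ### Convergence of left-endpoint Riemann sums. -/

section RiemannSum

open Filter Topology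

lemma tendsto_riemannSum_unit {k : ℝ → ℝ} (hk : Continuous k) :
    Tendsto (fun n : ℕ => ∑ i ∈ Finset.range n, (1 / n : ℝ) * k (i / n)) atTop
      (𝓝 (∫ x in (0 : ℝ)..1, k x)) := by
  rw [Metric.tendsto_atTop]
  intro ε hε
  have huc := isCompact_Icc.uniformContinuousOn_of_continuous
    (hk.continuousOn (s := Set.Icc (0 : ℝ) 1))
  rw [Metric.uniformContinuousOn_iff] at huc
  obtain ⟨δ, hδ, huc⟩ := huc (ε / 2) (by positivity)
  obtain ⟨N, hN⟩ := exists_nat_gt (1 / δ)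
  refine ⟨N + 1, fun n hn => ?_⟩
  have hn0 : (0 : ℝ) < n := by
    have : 0 < n := by omega
    exact_mod_cast this
  have hnδ : 1 / (n : ℝ) < δ := by
    rw [div_lt_iff₀ hn0]
    rw [div_lt_iff₀ hδ] at hN
    have : (N : ℝ) ≤ n := by exact_mod_cast (by omega : N ≤ n)
    nlinarith
  have hsplit : ∫ x in (0 : ℝ)..1, k x =
      ∑ i ∈ Finset.range n, ∫ x in ((i : ℝ) / n)..(((i + 1 : ℕ) : ℝ) / n), k x := by
    rw [intervalIntegral.sum_integral_adjacent_intervals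
      (a := fun i : ℕ => (i : ℝ) / n) fun i _ => hk.intervalIntegrable _ _]
    simp [hn0.ne']
  have hlen : ∀ i : ℕ, ((i + 1 : ℕ) : ℝ) / n - (i : ℝ) / n = 1 / n := fun i => by
    push_cast; ring
  have hconst : ∀ i : ℕ, (1 / n : ℝ) * k (i / n) =
      ∫ _ in ((i : ℝ) / n)..(((i + 1 : ℕ) : ℝ) / n), k (i / n) := fun i => by
    rw [intervalIntegral.integral_const, hlen, smul_eq_mul]
  rw [dist_comm, Real.dist_eq, hsplit, Finset.sum_congr rfl fun i _ => hconst i,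
    ← Finset.sum_sub_distrib]
  calc |∑ i ∈ Finset.range n, ((∫ x in ((i : ℝ) / n)..(((i + 1 : ℕ) : ℝ) / n), k x) -
        ∫ _ in ((i : ℝ) / n)..(((i + 1 : ℕ) : ℝ) / n), k (i / n))|
      ≤ ∑ i ∈ Finset.range n, ε / 2 * (1 / n) := by
        refine (Finset.abs_sum_le_sum_abs _ _).trans (Finset.sum_le_sum fun i hi => ?_)
        rw [← intervalIntegral.integral_sub (hk.intervalIntegrable _ _)
          intervalIntegrable_const, ← Real.norm_eq_abs]
        have hle : (i : ℝ) / n ≤ ((i + 1 : ℕ) : ℝ) / n := by gcongr; simp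
        have hin : ((i + 1 : ℕ) : ℝ) / n ≤ 1 := by
          rw [div_le_one hn0]
          exact_mod_cast Finset.mem_range.1 hi
        have hi0 : 0 ≤ (i : ℝ) / n := by positivity
        refine (intervalIntegral.norm_integral_le_of_norm_le_const (C := ε / 2)
          fun x hx => ?_).trans_eq (by rw [hlen, abs_of_pos (by positivity)])
        rw [Set.uIoc_of_le hle] at hx
        rw [← dist_eq_norm]
        refine (huc x ⟨by linarith [hx.1], by linarith [hx.2]⟩ _ ⟨hi0, by linarith⟩ ?_).le
        rw [Real.dist_eq, abs_of_pos (by linarith [hx.1])]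
        linarith [hx.2, hlen i]
    _ = ε / 2 := by
        rw [Finset.sum_const, Finset.card_range, nsmul_eq_mul]
        field_simp
    _ < ε := by linarith

lemma tendsto_riemannSum {h : ℝ → ℝ} (hh : Continuous h) (a b : ℝ) :
    Tendsto (fun n : ℕ => ∑ i ∈ Finset.range n, ((b - a) / n : ℝ) * h (a + (b - a) * (i / n)))
      atTop (𝓝 (∫ x in a..b, h x)) := by
  have h1 := (tendsto_riemannSum_unit
    (hh.comp (by fun_prop : Continuous fun x : ℝ => a + (b - a) * x))).const_mul (b - a)
  have h2 := intervalIntegral.smul_integral_comp_add_mul (a := 0) (b := 1) h (b - a) a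
  simp only [smul_eq_mul, mul_zero, mul_one, add_zero] at h2
  simp only [Function.comp_def] at h1
  rw [h2, show a + (b - a) = b by ring] at h1
  refine h1.congr fun n => ?_
  rw [Finset.mul_sum]
  exact Finset.sum_congr rfl fun i _ => by ring

end RiemannSum

/-! ### Gaussian spaces, their pointwise limits, and additive functionals. -/

section GaussianLimits

open Filter Topology

variable {Ω : Type*} [MeasurableSpace Ω]

/-- `X` is a measurable random variable with a centered normal law. -/
def IsCenteredNormal (X : Ω → ℝ) (P : Measure Ω) : Prop :=
  Measurable X ∧ ∃ v : NNReal, P.map X = gaussianReal 0 v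

variable {P : Measure Ω}

lemma IsCenteredNormal.memLp {X : Ω → ℝ} (hX : IsCenteredNormal X P) (n : ℕ) :
    MemLp X n P := by
  obtain ⟨hm, v, hv⟩ := hX
  have h : MemLp id n (P.map X) := by
    rw [hv]
    exact_mod_cast memLp_id_gaussianReal (μ := 0) (v := v) n
  simpa using (memLp_map_measure_iff (by fun_prop) hm.aemeasurable).1 h

lemma IsCenteredNormal.integrable_mul {X Y : Ω → ℝ} (hX : IsCenteredNormal X P)
    (hY : IsCenteredNormal Y P) : Integrable (fun ω => X ω * Y ω) P := by
  have h1 : MemLp X 2 P := by exact_mod_cast hX.memLp 2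
  have h2 : MemLp Y 2 P := by exact_mod_cast hY.memLp 2
  exact h1.integrable_mul h2

lemma IsCenteredNormal.integral_eq_zero {X : Ω → ℝ} (hX : IsCenteredNormal X P) :
    ∫ ω, X ω ∂P = 0 := by
  obtain ⟨hm, v, hv⟩ := hX
  rw [← integral_map (φ := X) (f := fun x => x) hm.aemeasurable (by fun_prop), hv,
    integral_id_gaussianReal]

lemma IsCenteredNormal.map_eq {X : Ω → ℝ} (hX : IsCenteredNormal X P) :
    P.map X = gaussianReal 0 (∫ ω, X ω ^ 2 ∂P).toNNReal := by
  obtain ⟨hm, v, hv⟩ := hX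
  rw [← integral_map (φ := X) (f := fun x => x ^ 2) hm.aemeasurable (by fun_prop), hv]
  have h := variance_id_gaussianReal (μ := 0) (v := v)
  rw [variance_eq_integral (by fun_prop)] at h
  simp only [id_eq, integral_id_gaussianReal, sub_zero] at h
  rw [h, Real.toNNReal_coe]

/-- A pointwise limit of centered normal random variables is centered normal. -/
theorem IsCenteredNormal.of_tendsto [IsProbabilityMeasure P] {Y : ℕ → Ω → ℝ} {X : Ω → ℝ}
    (hY : ∀ n, IsCenteredNormal (Y n) P)
    (hlim : ∀ ω, Tendsto (fun n => Y n ω) atTop (𝓝 (X ω))) : IsCenteredNormal X P := by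
  have hX : Measurable X := measurable_of_tendsto_metrizable (fun n => (hY n).1)
    (tendsto_pi_nhds.2 hlim)
  have hprob : IsProbabilityMeasure (P.map X) :=
    Measure.isProbabilityMeasure_map hX.aemeasurable
  choose hYm v hv using hY
  have hcf : ∀ {U : Ω → ℝ}, Measurable U → ∀ θ : ℝ, charFun (P.map U) θ =
      ∫ ω, Complex.exp (θ * U ω * Complex.I) ∂P := fun hU θ => by
    rw [charFun_apply_real, integral_map hU.aemeasurable (by fun_prop)]
  have hconv : ∀ θ : ℝ, Tendsto (fun n => Complex.exp (-(v n * θ ^ 2 / 2 : ℝ))) atTop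
      (𝓝 (charFun (P.map X) θ)) := by
    intro θ
    have h1 : ∀ n, Complex.exp (-(v n * θ ^ 2 / 2 : ℝ)) =
        ∫ ω, Complex.exp (θ * Y n ω * Complex.I) ∂P := fun n => by
      rw [← hcf (hYm n), hv n, charFun_gaussianReal]
      congr 1
      push_cast
      ring
    simp only [h1, hcf hX]
    refine tendsto_integral_of_dominated_convergence (fun _ => (1 : ℝ))
      (fun n => by have := hYm n; fun_prop) (integrable_const _)
      (fun n => ae_of_all _ fun ω => ?_) (ae_of_all _ fun ω => ?_)
    · rw [← Complex.ofReal_mul, Complex.norm_exp_ofReal_mul_I]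
    · have := hlim ω
      have hc : Continuous fun y : ℝ => Complex.exp (θ * y * Complex.I) := by fun_prop
      exact (hc.tendsto _).comp this
  have hφc : Continuous (charFun (P.map X)) := continuous_charFun
  have hφ0 : charFun (P.map X) 0 = 1 := by simp
  -- One nonzero frequency at which the limiting characteristic function does not vanish suffices:
  -- there the logarithm of the modulus recovers the variances `v n` and forces them to converge.
  obtain ⟨θ₀, hθ₀, hφθ⟩ : ∃ θ₀ : ℝ, θ₀ ≠ 0 ∧ charFun (P.map X) θ₀ ≠ 0 := by
    have h1 : ∀ᶠ θ in 𝓝 (0 : ℝ), charFun (P.map X) θ ≠ 0 :=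
      hφc.continuousAt.eventually_ne (by rw [hφ0]; exact one_ne_zero)
    have h2 : ∀ᶠ θ in 𝓝[≠] (0 : ℝ), charFun (P.map X) θ ≠ 0 := h1.filter_mono nhdsWithin_le_nhds
    obtain ⟨θ, h3, h4⟩ := (h2.and self_mem_nhdsWithin).exists
    exact ⟨θ, h4, h3⟩
  have hlog : Tendsto (fun n => -((v n : ℝ) * θ₀ ^ 2 / 2)) atTop
      (𝓝 (Real.log ‖charFun (P.map X) θ₀‖)) := by
    have h1 := ((hconv θ₀).norm).log (norm_ne_zero_iff.2 hφθ)
    refine h1.congr fun n => ?_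
    rw [← Complex.ofReal_neg, ← Complex.ofReal_exp, Complex.norm_real, Real.norm_eq_abs,
      Real.abs_exp, Real.log_exp]
  set w : ℝ := Real.log ‖charFun (P.map X) θ₀‖ * (-2 / θ₀ ^ 2) with hw
  have hvlim : Tendsto (fun n => (v n : ℝ)) atTop (𝓝 w) := by
    refine (hlog.mul_const (-2 / θ₀ ^ 2)).congr fun n => ?_
    field_simp
  have hw0 : 0 ≤ w := ge_of_tendsto' hvlim fun n => (v n).2
  refine ⟨hX, w.toNNReal, Measure.ext_of_charFun (funext fun θ => ?_)⟩
  refine tendsto_nhds_unique (hconv θ) ?_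
  rw [charFun_gaussianReal, Real.coe_toNNReal _ hw0]
  have hc : Continuous fun y : ℝ => Complex.exp (-(y * θ ^ 2 / 2 : ℝ)) := by fun_prop
  have h1 := (hc.tendsto w).comp hvlim
  have h2 : Complex.exp (θ * ((0 : ℝ) : ℂ) * Complex.I - w * θ ^ 2 / 2) =
      Complex.exp (-(w * θ ^ 2 / 2 : ℝ)) := by
    congr 1
    push_cast
    ring
  rw [h2]
  exact h1

/-- The space of pointwise limits of sequences of elements of a space of functions. -/
def seqLimits (L : Submodule ℝ (Ω → ℝ)) : Submodule ℝ (Ω → ℝ) where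
  carrier := {X | ∃ Y : ℕ → Ω → ℝ, (∀ n, Y n ∈ L) ∧
    ∀ ω, Tendsto (fun n => Y n ω) atTop (𝓝 (X ω))}
  add_mem' := by
    rintro X X' ⟨Y, hY, h⟩ ⟨Y', hY', h'⟩
    exact ⟨fun n => Y n + Y' n, fun n => L.add_mem (hY n) (hY' n), fun ω => (h ω).add (h' ω)⟩
  zero_mem' := ⟨fun _ => 0, fun _ => L.zero_mem, fun _ => tendsto_const_nhds⟩
  smul_mem' := by
    rintro c X ⟨Y, hY, h⟩
    exact ⟨fun n => c • Y n, fun n => L.smul_mem c (hY n), fun ω => (h ω).const_mul c⟩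

omit [MeasurableSpace Ω] in
lemma le_seqLimits (L : Submodule ℝ (Ω → ℝ)) : L ≤ seqLimits L := fun X hX =>
  ⟨fun _ => X, fun _ => hX, fun _ => tendsto_const_nhds⟩

lemma isCenteredNormal_seqLimits [IsProbabilityMeasure P] {L : Submodule ℝ (Ω → ℝ)}
    (hL : ∀ X ∈ L, IsCenteredNormal X P) : ∀ X ∈ seqLimits L, IsCenteredNormal X P := by
  rintro X ⟨Y, hY, h⟩
  exact IsCenteredNormal.of_tendsto (fun n => hL _ (hY n)) h

lemma isCenteredNormal_span {W : ℝ → Ω → ℝ} (hW : IsGaussianProcess W P)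
    (hm : ∀ t, Measurable (W t)) (h0 : ∀ t, ∫ ω, W t ω ∂P = 0) :
    ∀ X ∈ Submodule.span ℝ (Set.range W), IsCenteredNormal X P := by
  intro X hX
  obtain ⟨c, rfl⟩ := Finsupp.mem_span_range_iff_exists_finsupp.1 hX
  have hpt : (c.sum fun i a => a • W i) = fun ω => ∑ i ∈ c.support, c i * W i ω := by
    ext ω
    simp [Finsupp.sum]
  rw [hpt]
  let ℓ : (c.support → ℝ) →L[ℝ] ℝ := ∑ i : c.support, c i • ContinuousLinearMap.proj i
  have hg := (hW.hasGaussianLaw c.support).map_fun ℓ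
  have heq : (fun ω => ℓ (c.support.restrict (W · ω))) =
      fun ω => ∑ i ∈ c.support, c i * W i ω := by
    ext ω
    rw [← Finset.sum_coe_sort]
    simp [ℓ]
  rw [heq] at hg
  have hmean : ∫ ω, ∑ i ∈ c.support, c i * W i ω ∂P = 0 := by
    rw [integral_finsetSum _ fun i _ => ((hW.hasGaussianLaw_eval i).integrable).const_mul _]
    simp [integral_const_mul, h0]
  exact ⟨by fun_prop, _, by rw [hg.map_eq_gaussianReal, hmean]⟩

variable {L : Submodule ℝ (Ω → ℝ)}

omit [MeasurableSpace Ω] in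
lemma sum_mul_mem {n : ℕ} {Z : Fin n → Ω → ℝ} (hZ : ∀ i, Z i ∈ L) (c : Fin n → ℝ) :
    (fun ω => ∑ i, c i * Z i ω) ∈ L := by
  have : (fun ω => ∑ i, c i * Z i ω) = ∑ i, c i • Z i := by ext ω; simp
  rw [this]
  exact L.sum_mem fun i _ => L.smul_mem _ (hZ i)

/-- Every linear functional of the vector is a linear combination of the `Z i`, hence lies in `L`
and is normal. This is why linear subspaces, rather than single variables, are carried through the
limits. -/
lemma isGaussian_map_pi (hL : ∀ X ∈ L, IsCenteredNormal X P) {n : ℕ} {Z : Fin n → Ω → ℝ}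
    (hZ : ∀ i, Z i ∈ L) : IsGaussian (P.map fun ω i => Z i ω) := by
  refine isGaussian_of_map_eq_gaussianReal fun ℓ => ?_
  have hm : Measurable fun ω i => Z i ω := measurable_pi_lambda _ fun i => (hL _ (hZ i)).1
  rw [Measure.map_map (by fun_prop) hm]
  have : (ℓ ∘ fun ω i => Z i ω) = fun ω => ∑ i, ℓ (Pi.single i 1) * Z i ω := by
    ext ω
    have h := ℓ.toLinearMap.pi_apply_eq_sum_univ (fun i => Z i ω)
    simp only [ContinuousLinearMap.coe_coe, smul_eq_mul] at h
    simp only [Function.comp_apply, h]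
    refine Finset.sum_congr rfl fun i _ => ?_
    rw [mul_comm]
    congr 2
    ext j
    simp [Pi.single_apply, eq_comm]
  rw [this]
  obtain ⟨_, v, hv⟩ := hL _ (sum_mul_mem hZ fun i => ℓ (Pi.single i 1))
  exact ⟨0, v, hv⟩

lemma integral_map_pi_eq_zero (hL : ∀ X ∈ L, IsCenteredNormal X P) {n : ℕ}
    {Z : Fin n → Ω → ℝ} (hZ : ∀ i, Z i ∈ L) : ∫ x, x ∂(P.map fun ω i => Z i ω) = 0 := by
  have hg := isGaussian_map_pi hL hZ
  have hm : Measurable fun ω i => Z i ω := measurable_pi_lambda _ fun i => (hL _ (hZ i)).1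
  ext i
  have h := IsGaussian.integral_dual (μ := P.map fun ω i => Z i ω) (ContinuousLinearMap.proj i)
  rw [integral_map hm.aemeasurable (by fun_prop)] at h
  simp only [ContinuousLinearMap.proj_apply] at h
  rw [Pi.zero_apply, ← h]
  exact (hL _ (hZ i)).integral_eq_zero

/-- Fourth moment bound for additive functionals of a centered Gaussian vector. -/
theorem integral_sum_pow_four_le (hL : ∀ X ∈ L, IsCenteredNormal X P) {n : ℕ}
    {Z : Fin n → Ω → ℝ} (hZ : ∀ i, Z i ∈ L) {g g' : ℝ → ℝ} (hg : ∀ x, HasDerivAt g (g' x) x)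
    (hg' : Continuous g') {M B : ℝ} (hM : ∀ x, |g' x| ≤ M) (hB : ∀ x, |g x| ≤ B)
    (h0 : ∀ i, ∫ ω, g (Z i ω) ∂P = 0) {w : ℝ} (hw : 0 ≤ w) :
    ∫ ω, (∑ i, w * g (Z i ω)) ^ 4 ∂P ≤ (Real.pi / 2) ^ 4 *
      ((M ^ 2 * ∑ i, ∑ j, w ^ 2 * |∫ ω, Z i ω * Z j ω ∂P|) ^ 2 * gaussianFourthMoment) := by
  have hG := isGaussian_map_pi hL hZ
  have hm : Measurable fun ω i => Z i ω := measurable_pi_lambda _ fun i => (hL _ (hZ i)).1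
  have hgc : Continuous g := continuous_iff_continuousAt.2 fun x => (hg x).continuousAt
  have hM0 : 0 ≤ M := (abs_nonneg _).trans (hM 0)
  have hP : IsProbabilityMeasure P := by
    have : IsProbabilityMeasure (P.map fun ω i => Z i ω) := inferInstance
    exact Measure.isProbabilityMeasure_of_map (fun ω i => Z i ω)
  have hint : ∀ i j, Integrable (fun ω => Z i ω * Z j ω) P := fun i j =>
    (hL _ (hZ i)).integrable_mul (hL _ (hZ j))
  have hgint : ∀ i, Integrable (fun ω => g (Z i ω)) P := fun i =>
    Integrable.of_bound (by have := (hL _ (hZ i)).1; fun_prop) B (ae_of_all _ fun ω => hB _)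
  let f : (Fin n → ℝ) → ℝ := fun x => ∑ i, w * g (x i)
  let f' : (Fin n → ℝ) → (Fin n → ℝ) →L[ℝ] ℝ := fun x =>
    ∑ i, (w * g' (x i)) • ContinuousLinearMap.proj i
  have hf : ∀ x, HasFDerivAt f (f' x) x := by
    intro x
    refine HasFDerivAt.fun_sum fun i _ => ?_
    rw [mul_smul]
    exact (((hg (x i)).comp_hasFDerivAt x (hasFDerivAt_apply i x))).const_mul w
  have key := integral_pow_four_le_of_isGaussian (P.map fun ω i => Z i ω)
    (integral_map_pi_eq_zero hL hZ) (f := f) (f' := f') hf (by fun_prop)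
    (L := M ^ 2 * ∑ i, ∑ j, w ^ 2 * |∫ ω, Z i ω * Z j ω ∂P|) ?_ (B := ∑ _i : Fin n, w * B) ?_ ?_
  · rwa [integral_map hm.aemeasurable (by fun_prop)] at key
  · intro x
    rw [integral_map hm.aemeasurable (by fun_prop)]
    -- With `x` frozen, the variance of the differential is a quadratic form in the covariances,
    -- with coefficients bounded by $(wM)^2$.
    have hexp : ∀ ω, (f' x fun i => Z i ω) ^ 2 =
        ∑ i, ∑ j, (w * g' (x i)) * (w * g' (x j)) * (Z i ω * Z j ω) := by
      intro ω
      simp only [f', _root_.sum_apply, _root_.smul_apply,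
        ContinuousLinearMap.proj_apply, smul_eq_mul, sq, Finset.sum_mul_sum]
      exact Finset.sum_congr rfl fun i _ => Finset.sum_congr rfl fun j _ => by ring
    simp only [hexp]
    rw [integral_finsetSum _ fun i _ => integrable_finsetSum _ fun j _ =>
      (hint i j).const_mul _, Finset.mul_sum]
    refine Finset.sum_le_sum fun i _ => ?_
    rw [integral_finsetSum _ fun j _ => (hint i j).const_mul _, Finset.mul_sum]
    refine Finset.sum_le_sum fun j _ => ?_
    rw [integral_const_mul]
    refine (le_abs_self _).trans ?_
    rw [abs_mul, abs_mul, abs_mul, abs_mul, abs_of_nonneg hw]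
    calc w * |g' (x i)| * (w * |g' (x j)|) * |∫ ω, Z i ω * Z j ω ∂P|
        ≤ w * M * (w * M) * |∫ ω, Z i ω * Z j ω ∂P| := by
          gcongr
          · exact hM _
          · exact hM _
      _ = _ := by ring
  · intro x
    refine (Finset.abs_sum_le_sum_abs _ _).trans (Finset.sum_le_sum fun i _ => ?_)
    rw [abs_mul, abs_of_nonneg hw]
    exact mul_le_mul_of_nonneg_left (hB _) hw
  · rw [integral_map hm.aemeasurable (by fun_prop)]
    simp only [f]
    rw [integral_finsetSum _ fun i _ => (hgint i).const_mul _]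
    simp [integral_const_mul, h0]

end GaussianLimits

/-! ### Second differences and sums of powers. -/

section PowerIncrements

lemma abs_rpow_two_mul (x H : ℝ) : |x| ^ (2 * H) = (x ^ 2) ^ H := by
  rw [Real.rpow_mul (abs_nonneg x), Real.rpow_two, sq_abs]

/-- Bernoulli's inequality for the concave power $H\le1$, applied to $(1+z)^2=1+(2z+z^2)$. Squaring
first makes it valid for every real $z$. -/
lemma abs_one_add_rpow_le {H : ℝ} (hH : 0 ≤ H) (hH1 : H ≤ 1) (z : ℝ) :
    |1 + z| ^ (2 * H) ≤ 1 + H * (2 * z + z ^ 2) := by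
  rw [abs_rpow_two_mul, show (1 + z) ^ 2 = 1 + (2 * z + z ^ 2) by ring]
  exact rpow_one_add_le_one_add_mul_self (by nlinarith [sq_nonneg (1 + z)]) hH hH1

lemma le_abs_one_add_rpow {H : ℝ} (hH : 1 / 2 ≤ H) (z : ℝ) :
    1 + 2 * H * z ≤ |1 + z| ^ (2 * H) := by
  rcases le_or_gt (-1) z with hz | hz
  · rw [abs_of_nonneg (by linarith)]
    exact one_add_mul_self_le_rpow_one_add hz (by linarith)
  · have : 0 ≤ |1 + z| ^ (2 * H) := by positivity
    nlinarith

/-- The two Bernoulli bounds rescaled by $d$. They share their constant and linear terms, so only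
quadratic errors survive in a mixed difference, with no restriction on the size of $x/d$. -/
lemma abs_add_rpow_bounds {H : ℝ} (hH : 1 / 2 ≤ H) (hH1 : H ≤ 1) {d : ℝ} (hd : 0 < d) (x : ℝ) :
    d ^ (2 * H - 2) * d ^ 2 + 2 * H * d ^ (2 * H - 2) * (d * x) ≤ |d + x| ^ (2 * H) ∧
    |d + x| ^ (2 * H) ≤
      d ^ (2 * H - 2) * d ^ 2 + H * d ^ (2 * H - 2) * (2 * (d * x) + x ^ 2) := by
  have hq : d ^ (2 * H) = d ^ (2 * H - 2) * d ^ 2 := by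
    rw [← Real.rpow_two, ← Real.rpow_add hd]
    congr 1
    ring
  have hs : |d + x| ^ (2 * H) = d ^ (2 * H - 2) * d ^ 2 * |1 + x / d| ^ (2 * H) := by
    rw [← hq, show d + x = d * (1 + x / d) by field_simp, abs_mul, abs_of_pos hd,
      Real.mul_rpow hd.le (abs_nonneg _)]
  have hp : 0 ≤ d ^ (2 * H - 2) * d ^ 2 := by positivity
  have h1 := mul_le_mul_of_nonneg_left (le_abs_one_add_rpow hH (x / d)) hp
  have h2 := mul_le_mul_of_nonneg_left (abs_one_add_rpow_le (by linarith) hH1 (x / d)) hp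
  rw [hs]
  constructor
  · refine Eq.trans_le ?_ h1
    field_simp
  · refine h2.trans_eq ?_
    field_simp

/-- A bound for the mixed second difference of `|x| ^ (2 * H)`. -/
lemma abs_mixed_difference_le {H : ℝ} (hH : 1 / 2 ≤ H) (hH1 : H ≤ 1) {d : ℝ} (hd : 0 < d)
    {a b : ℝ} (ha : 0 ≤ a) (hb : 0 ≤ b) :
    |(|d + b| ^ (2 * H) + |d - a| ^ (2 * H) - |d| ^ (2 * H) - |d - a + b| ^ (2 * H))| ≤
      H * d ^ (2 * H - 2) * (a ^ 2 + b ^ 2) := by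
  obtain ⟨l1, u1⟩ := abs_add_rpow_bounds hH hH1 hd b
  obtain ⟨l2, u2⟩ := abs_add_rpow_bounds hH hH1 hd (-a)
  obtain ⟨l3, u3⟩ := abs_add_rpow_bounds hH hH1 hd (-a + b)
  obtain ⟨l4, u4⟩ := abs_add_rpow_bounds hH hH1 hd 0
  rw [← sub_eq_add_neg] at l2 u2
  rw [show d + (-a + b) = d - a + b by ring] at l3 u3
  rw [add_zero] at l4 u4
  have hk : 0 ≤ H * d ^ (2 * H - 2) := by
    have : 0 ≤ H := by linarith
    positivity
  have hab : 0 ≤ H * d ^ (2 * H - 2) * (a * b) := by positivity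
  -- Constant and linear parts cancel. The upper bound leaves $a^2+b^2$, the lower one $-(a-b)^2$,
  -- which is at least $-(a^2+b^2)$ because $ab\ge0$.
  rw [abs_le]
  constructor <;> nlinarith

/-- Telescoping of $a(n+1)^{a-1}\le(n+1)^a-n^a$, which is Bernoulli's inequality at $-1/(n+1)$. -/
lemma sum_rpow_le {a : ℝ} (ha : 0 < a) (ha1 : a ≤ 1) (n : ℕ) :
    ∑ k ∈ Finset.range n, ((k : ℝ) + 1) ^ (a - 1) ≤ (n : ℝ) ^ a / a := by
  induction n with
  | zero => simp [ha.ne']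
  | succ n ih =>
    rw [Finset.sum_range_succ]
    refine (add_le_add_left ih _).trans ?_
    rw [← le_sub_iff_add_le', ← sub_div, le_div_iff₀ ha]
    have hn : (0 : ℝ) < n + 1 := by positivity
    have h := rpow_one_add_le_one_add_mul_self (s := -(1 / ((n : ℝ) + 1))) (by
      rw [neg_le_neg_iff, div_le_one hn]; linarith [(Nat.cast_nonneg n : (0 : ℝ) ≤ n)]) ha.le ha1
    have h2 := mul_le_mul_of_nonneg_left h (by positivity : 0 ≤ ((n : ℝ) + 1) ^ a)
    rw [← Real.mul_rpow hn.le (by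
      rw [← sub_eq_add_neg, sub_nonneg, div_le_one hn]
      linarith [(Nat.cast_nonneg n : (0 : ℝ) ≤ n)]),
      show ((n : ℝ) + 1) * (1 + -(1 / ((n : ℝ) + 1))) = n by field_simp; ring] at h2
    have h3 : ((n : ℝ) + 1) ^ a = ((n : ℝ) + 1) ^ (a - 1) * ((n : ℝ) + 1) := by
      rw [← Real.rpow_add_one hn.ne', sub_add_cancel]
    push_cast
    have h4 : ((n : ℝ) + 1) ^ a * (1 + a * -(1 / ((n : ℝ) + 1))) =
        ((n : ℝ) + 1) ^ a - ((n : ℝ) + 1) ^ (a - 1) * a := by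
      rw [h3]; field_simp; ring
    linarith

end PowerIncrements

/-! ### Moments of exponential variables and of their differences. -/

section ExponentialLaw

/-- The standard exponential law. -/
noncomputable def expLaw : Measure ℝ :=
  (volume.restrict (Set.Ioi 0)).withDensity fun u => ENNReal.ofReal (Real.exp (-u))

lemma integral_expLaw (h : ℝ → ℝ) :
    ∫ u, h u ∂expLaw = ∫ u in Set.Ioi 0, Real.exp (-u) * h u := by
  rw [expLaw, integral_withDensity_eq_integral_toReal_smul (by fun_prop) (by simp)]
  simp [Real.exp_nonneg]

lemma integrable_expLaw {h : ℝ → ℝ} :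
    Integrable h expLaw ↔ IntegrableOn (fun u => Real.exp (-u) * h u) (Set.Ioi 0) := by
  rw [expLaw, integrable_withDensity_iff_integrable_smul' (by fun_prop) (by simp)]
  simp [IntegrableOn, Real.exp_nonneg]

instance : IsProbabilityMeasure expLaw := by
  constructor
  rw [expLaw, withDensity_apply _ MeasurableSet.univ, Measure.restrict_univ,
    ← ofReal_integral_eq_lintegral_ofReal (integrableOn_exp_neg_Ioi 0)
      (ae_of_all _ fun u => Real.exp_nonneg _), integral_exp_neg_Ioi_zero, ENNReal.ofReal_one]

lemma ae_expLaw_pos : ∀ᵐ u ∂expLaw, 0 < u :=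
  (withDensity_absolutelyContinuous _ _).ae_le (ae_restrict_mem measurableSet_Ioi)

lemma integrable_rpow_expLaw {p : ℝ} (hp : 0 ≤ p) : Integrable (fun u => |u| ^ p) expLaw := by
  rw [integrable_expLaw]
  refine (Real.GammaIntegral_convergent (s := p + 1) (by linarith)).congr_fun
    (fun u hu => ?_) measurableSet_Ioi
  simp only [add_sub_cancel_right, abs_of_pos (Set.mem_Ioi.1 hu)]

lemma integral_rpow_expLaw {p : ℝ} (hp : 0 ≤ p) :
    ∫ u, |u| ^ p ∂expLaw = Real.Gamma (p + 1) := by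
  rw [integral_expLaw, Real.Gamma_eq_integral (by linarith)]
  refine setIntegral_congr_fun measurableSet_Ioi (fun u hu => ?_)
  simp only [add_sub_cancel_right, abs_of_pos (Set.mem_Ioi.1 hu)]

lemma integrable_sq_expLaw : Integrable (fun u => u ^ 2) expLaw := by
  simpa using integrable_rpow_expLaw (p := 2) (by norm_num)

lemma integral_sq_expLaw : ∫ u, u ^ 2 ∂expLaw = 2 := by
  have h := integral_rpow_expLaw (p := 2) (by norm_num)
  have h2 : Real.Gamma (2 + 1) = 2 := by
    rw [Real.Gamma_add_one (by norm_num), Real.Gamma_two, mul_one]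
  rw [h2] at h
  simpa using h

/-- The positive part of `v - u`, raised to the power `p`. -/
noncomputable def posPartRpow (p : ℝ) (q : ℝ × ℝ) : ℝ :=
  if q.1 < q.2 then (q.2 - q.1) ^ p else 0

lemma measurable_posPartRpow (p : ℝ) : Measurable (posPartRpow p) := by
  unfold posPartRpow
  exact Measurable.ite (measurableSet_lt measurable_fst measurable_snd) (by fun_prop) (by fun_prop)

lemma integrable_posPartRpow {p : ℝ} (hp : 0 ≤ p) :
    Integrable (posPartRpow p) (expLaw.prod expLaw) := by
  refine ((integrable_rpow_expLaw hp).comp_snd expLaw).mono'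
    (measurable_posPartRpow p).aestronglyMeasurable ?_
  have h : ∀ᵐ q : ℝ × ℝ ∂(expLaw.prod expLaw), 0 < q.1 :=
    Measure.quasiMeasurePreserving_fst.ae ae_expLaw_pos
  filter_upwards [h] with q hq
  unfold posPartRpow
  split_ifs with h1
  · rw [Real.norm_of_nonneg (Real.rpow_nonneg (by linarith) _), abs_of_pos (hq.trans h1)]
    exact Real.rpow_le_rpow (by linarith) (by linarith) hp
  · simp only [norm_zero]; positivity

/-- Lack of memory: the shift $v\mapsto v+u$ extracts the factor $e^{-u}$. -/
lemma integral_posPartRpow_right {p : ℝ} (hp : 0 ≤ p) {u : ℝ} (hu : 0 < u) :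
    ∫ v, posPartRpow p (u, v) ∂expLaw = Real.exp (-u) * Real.Gamma (p + 1) := by
  have h1 : ∫ v, posPartRpow p (u, v) ∂expLaw =
      ∫ v in Set.Ioi u, Real.exp (-v) * (v - u) ^ p := by
    rw [integral_expLaw, ← integral_indicator measurableSet_Ioi,
      ← integral_indicator measurableSet_Ioi]
    congr 1 with v
    simp only [Set.indicator_apply, Set.mem_Ioi, posPartRpow]
    split_ifs with h2 h3 h4 <;> first | rfl | (exfalso; linarith) | simp
  rw [h1, Real.Gamma_eq_integral (by linarith), ← integral_const_mul,
    ← integral_indicator measurableSet_Ioi, ← integral_indicator measurableSet_Ioi,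
    ← integral_add_right_eq_self _ u]
  congr 1 with v
  simp only [Set.indicator_apply, Set.mem_Ioi, add_sub_cancel_right, lt_add_iff_pos_left]
  split_ifs
  · rw [neg_add, Real.exp_add]; ring
  · rfl

lemma integral_posPartRpow {p : ℝ} (hp : 0 ≤ p) :
    ∫ q, posPartRpow p q ∂(expLaw.prod expLaw) = Real.Gamma (p + 1) / 2 := by
  rw [integral_prod _ (integrable_posPartRpow hp)]
  have h1 : ∫ u, ∫ v, posPartRpow p (u, v) ∂expLaw ∂expLaw =
      ∫ u, Real.exp (-u) * Real.Gamma (p + 1) ∂expLaw :=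
    integral_congr_ae (by
      filter_upwards [ae_expLaw_pos] with u hu using integral_posPartRpow_right hp hu)
  rw [h1, integral_mul_const, integral_expLaw]
  have h2 := integral_exp_mul_Ioi (a := -2) (by norm_num) 0
  have h3 : ∀ u : ℝ, Real.exp (-u) * Real.exp (-u) = Real.exp (-2 * u) := fun u => by
    rw [← Real.exp_add]; ring_nf
  simp only [h3, h2]
  norm_num
  ring

lemma abs_sub_rpow_eq {p : ℝ} (hp : 0 < p) (q : ℝ × ℝ) :
    |q.2 - q.1| ^ p = posPartRpow p q + posPartRpow p q.swap := by
  unfold posPartRpow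
  rcases lt_trichotomy q.1 q.2 with h | h | h
  · simp [h, h.le, abs_of_pos (sub_pos.2 h)]
  · simp [h, hp.ne']
  · simp [h, h.le, abs_of_neg (sub_neg.2 h)]

lemma integrable_abs_sub_rpow {p : ℝ} (hp : 0 < p) :
    Integrable (fun q : ℝ × ℝ => |q.2 - q.1| ^ p) (expLaw.prod expLaw) := by
  simp only [abs_sub_rpow_eq hp]
  exact (integrable_posPartRpow hp.le).add (integrable_posPartRpow hp.le).swap

/-- The absolute difference of two independent standard exponential variables is again standard
exponential; this is the corresponding statement for moments. -/
lemma integral_abs_sub_rpow {p : ℝ} (hp : 0 < p) :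
    ∫ q : ℝ × ℝ, |q.2 - q.1| ^ p ∂(expLaw.prod expLaw) = Real.Gamma (p + 1) := by
  have hs : Integrable (fun q : ℝ × ℝ => posPartRpow p q.swap) (expLaw.prod expLaw) :=
    (integrable_posPartRpow hp.le).swap
  simp only [abs_sub_rpow_eq hp]
  rw [integral_add (integrable_posPartRpow hp.le) hs, integral_prod_swap, integral_posPartRpow hp.le]
  ring

end ExponentialLaw

/-! ### The substitution $s=t-\varepsilon u$ in the kernel integral. -/

section ChangeOfVariables

variable {ε : ℝ} (k : ℝ → ℝ) (t : ℝ)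

lemma indicator_Iio_comp (hε : 0 < ε) (u : ℝ) :
    (Set.Iio t).indicator (fun s => Real.exp (-(t - s) / ε) * k s) (t - ε * u) =
      (Set.Ioi 0).indicator (fun u => Real.exp (-u) * k (t - ε * u)) u := by
  have h : t - ε * u < t ↔ 0 < u := by rw [sub_lt_self_iff, mul_pos_iff_of_pos_left hε]
  simp only [Set.indicator_apply, Set.mem_Iio, Set.mem_Ioi, h]
  congr 4
  field_simp
  ring

lemma integral_Iic_exp_eq (hε : 0 < ε) :
    ∫ s in Set.Iic t, Real.exp (-(t - s) / ε) * k s = ε * ∫ u, k (t - ε * u) ∂expLaw := by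
  rw [integral_Iic_eq_integral_Iio, ← integral_indicator measurableSet_Iio, integral_expLaw,
    ← integral_indicator measurableSet_Ioi]
  simp only [← indicator_Iio_comp k t hε]
  rw [Measure.integral_comp_mul_left (fun y =>
    (Set.Iio t).indicator (fun s => Real.exp (-(t - s) / ε) * k s) (t - y)) ε,
    integral_sub_left_eq_self _ volume t, abs_of_pos (inv_pos.2 hε), smul_eq_mul,
    mul_inv_cancel_left₀ hε.ne']

lemma integrable_expLaw_iff_integrableOn_Iic (hε : 0 < ε) :
    Integrable (fun u => k (t - ε * u)) expLaw ↔
      IntegrableOn (fun s => Real.exp (-(t - s) / ε) * k s) (Set.Iic t) := by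
  rw [integrable_expLaw, ← integrable_indicator_iff measurableSet_Ioi,
    integrableOn_Iic_iff_integrableOn_Iio, ← integrable_indicator_iff measurableSet_Iio,
    ← integrable_congr (ae_of_all _ fun u => indicator_Iio_comp k t hε u),
    integrable_comp_mul_left_iff (fun y =>
      (Set.Iio t).indicator (fun s => Real.exp (-(t - s) / ε) * k s) (t - y)) hε.ne']
  refine ⟨fun h => ?_, fun h => h.comp_sub_left t⟩
  simpa using h.comp_sub_left t

end ChangeOfVariables

/-! ### Gaussianity, variance and covariance decay of the Ornstein–Uhlenbeck process. -/

/-- A fractional Brownian motion all of whose paths are continuous and integrable against the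
kernel of the `ε`-scaled fractional Ornstein–Uhlenbeck process. -/
structure IsRegularFBM {Ω : Type*} [MeasurableSpace Ω] (H ε : ℝ) (W : ℝ → Ω → ℝ)
    (P : Measure Ω) : Prop where
  gaussian : IsGaussianProcess W P
  mean_zero : ∀ t, ∫ ω, W t ω ∂P = 0
  covariance : ∀ t s, ∫ ω, W t ω * W s ω ∂P =
    sigmaHSq H / 2 * (|t| ^ (2 * H) + |s| ^ (2 * H) - |t - s| ^ (2 * H))
  measurable : ∀ t, Measurable (W t)
  continuous : ∀ ω, Continuous fun t => W t ω
  integrableOn : ∀ ω, IntegrableOn (fun s => Real.exp (s / ε) * W s ω) (Set.Iic 0)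

namespace IsRegularFBM

open Filter Topology

variable {Ω : Type*} [MeasurableSpace Ω] {H ε : ℝ} {W : ℝ → Ω → ℝ} {P : Measure Ω}

lemma exp_mul_eq (t s : ℝ) (x : ℝ) :
    Real.exp (-(t - s) / ε) * x = Real.exp (-t / ε) * (Real.exp (s / ε) * x) := by
  rw [← mul_assoc, ← Real.exp_add]
  congr 2
  ring

lemma integrableOn_exp_Iic {w : ℝ → ℝ} (hw : Continuous w)
    (h : IntegrableOn (fun s => Real.exp (s / ε) * w s) (Set.Iic 0)) (t : ℝ) :
    IntegrableOn (fun s => Real.exp (s / ε) * w s) (Set.Iic t) := by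
  have h1 : IntegrableOn (fun s => Real.exp (s / ε) * w s) (Set.Icc 0 t) :=
    (by fun_prop : Continuous fun s => Real.exp (s / ε) * w s).integrableOn_Icc
  refine (h.union h1).mono_set fun s hs => ?_
  rcases le_or_gt s 0 with h0 | h0
  · exact Or.inl h0
  · exact Or.inr ⟨h0.le, hs⟩

/-- The kernel factors as $e^{-t/\varepsilon}e^{s/\varepsilon}$, so integrability up to time $0$
gives it for all $t$ at once, outside a single null set. -/
lemma integrableOn_kernel {w : ℝ → ℝ} (hw : Continuous w)
    (h : IntegrableOn (fun s => Real.exp (s / ε) * w s) (Set.Iic 0)) (t : ℝ) :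
    IntegrableOn (fun s => Real.exp (-(t - s) / ε) * w s) (Set.Iic t) := by
  simp only [exp_mul_eq]
  exact (integrableOn_exp_Iic hw h t).const_mul _

/-- The exponential law has mass one, so $W_t$ can be moved under the integral. Only increments of
$W$ remain, which is the source of stationarity. -/
lemma fOU_eq_integral (hW : IsRegularFBM H ε W P) (hε : 0 < ε) (t : ℝ) (ω : Ω) :
    fOU H ε W t ω = ε ^ (-H) * ∫ u, (W t ω - W (t - ε * u) ω) ∂expLaw := by
  have hi := (integrable_expLaw_iff_integrableOn_Iic (fun s => W s ω) t hε).2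
    (integrableOn_kernel (hW.continuous ω) (hW.integrableOn ω) t)
  rw [fOU, integral_Iic_exp_eq (fun s => W s ω) t hε, integral_sub (integrable_const _) hi,
    integral_const, probReal_univ, one_smul, ← mul_assoc, ← Real.rpow_add_one hε.ne']
  ring_nf

lemma continuous_fOU (hW : IsRegularFBM H ε W P) (ω : Ω) :
    Continuous fun t => fOU H ε W t ω := by
  have hc : Continuous fun s => Real.exp (s / ε) * W s ω := by
    have := hW.continuous ω
    fun_prop
  have heq : ∀ t, ∫ s in Set.Iic t, Real.exp (-(t - s) / ε) * W s ω = Real.exp (-t / ε) *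
      ((∫ s in Set.Iic 0, Real.exp (s / ε) * W s ω) + ∫ s in 0..t, Real.exp (s / ε) * W s ω) := by
    intro t
    simp only [exp_mul_eq]
    rw [integral_const_mul, ← intervalIntegral.integral_Iic_sub_Iic (hW.integrableOn ω)
      (integrableOn_exp_Iic (hW.continuous ω) (hW.integrableOn ω) t)]
    ring
  have hp : Continuous fun t => ∫ s in 0..t, Real.exp (s / ε) * W s ω :=
    intervalIntegral.continuous_primitive (fun a b => hc.intervalIntegrable a b) 0
  have := hW.continuous ω
  simp only [fOU, heq]
  fun_prop

/-- Two successive limits are taken: Riemann sums for the integral over $[-n,t]$, then $n\to\infty$.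
-/
lemma fOU_mem (hW : IsRegularFBM H ε W P) (t : ℝ) :
    fOU H ε W t ∈ seqLimits (seqLimits (Submodule.span ℝ (Set.range W))) := by
  have hspan : ∀ s, W s ∈ Submodule.span ℝ (Set.range W) := fun s =>
    Submodule.subset_span ⟨s, rfl⟩
  have hI : (fun ω => ∫ s in Set.Iic t, Real.exp (-(t - s) / ε) * W s ω) ∈
      seqLimits (seqLimits (Submodule.span ℝ (Set.range W))) := by
    refine ⟨fun n ω => ∫ s in (-(n : ℝ))..t, Real.exp (-(t - s) / ε) * W s ω, fun n => ?_,
      fun ω => ?_⟩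
    · refine ⟨fun m ω => ∑ i ∈ Finset.range m, ((t - -(n : ℝ)) / m : ℝ) *
        (Real.exp (-(t - (-(n : ℝ) + (t - -(n : ℝ)) * (i / m))) / ε) *
          W (-(n : ℝ) + (t - -(n : ℝ)) * (i / m)) ω), fun m => ?_, fun ω => ?_⟩
      · have : (fun ω => ∑ i ∈ Finset.range m, ((t - -(n : ℝ)) / m : ℝ) *
            (Real.exp (-(t - (-(n : ℝ) + (t - -(n : ℝ)) * (i / m))) / ε) *
            W (-(n : ℝ) + (t - -(n : ℝ)) * (i / m)) ω)) =
            ∑ i ∈ Finset.range m, (((t - -(n : ℝ)) / m : ℝ) *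
            Real.exp (-(t - (-(n : ℝ) + (t - -(n : ℝ)) * (i / m))) / ε)) •
              W (-(n : ℝ) + (t - -(n : ℝ)) * (i / m)) := by
          ext ω
          simp [mul_assoc]
        beta_reduce
        rw [this]
        exact Submodule.sum_mem _ fun i _ => Submodule.smul_mem _ _ (hspan _)
      · have := hW.continuous ω
        exact tendsto_riemannSum
          (by fun_prop : Continuous fun s => Real.exp (-(t - s) / ε) * W s ω) (-(n : ℝ)) t
    · exact intervalIntegral_tendsto_integral_Iic t
        (integrableOn_kernel (hW.continuous ω) (hW.integrableOn ω) t)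
        (tendsto_neg_atTop_atBot.comp tendsto_natCast_atTop_atTop)
  have heq : fOU H ε W t = ε ^ (-H) • W t -
      ε ^ (-1 - H) • fun ω => ∫ s in Set.Iic t, Real.exp (-(t - s) / ε) * W s ω := by
    ext ω
    simp [fOU]
  rw [heq]
  exact Submodule.sub_mem _ (Submodule.smul_mem _ _ (le_seqLimits _ (le_seqLimits _ (hspan t))))
    (Submodule.smul_mem _ _ hI)

lemma isCenteredNormal_of_mem [IsProbabilityMeasure P] (hW : IsRegularFBM H ε W P) :
    ∀ X ∈ seqLimits (seqLimits (Submodule.span ℝ (Set.range W))), IsCenteredNormal X P :=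
  isCenteredNormal_seqLimits (isCenteredNormal_seqLimits
    (isCenteredNormal_span hW.gaussian hW.measurable hW.mean_zero))

lemma isCenteredNormal_fOU [IsProbabilityMeasure P] (hW : IsRegularFBM H ε W P) (t : ℝ) :
    IsCenteredNormal (fOU H ε W t) P :=
  hW.isCenteredNormal_of_mem _ (hW.fOU_mem t)

lemma isCenteredNormal [IsProbabilityMeasure P] (hW : IsRegularFBM H ε W P) (t : ℝ) :
    IsCenteredNormal (W t) P :=
  isCenteredNormal_span hW.gaussian hW.measurable hW.mean_zero _ (Submodule.subset_span ⟨t, rfl⟩)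

lemma isCenteredNormal_sub [IsProbabilityMeasure P] (hW : IsRegularFBM H ε W P) (t s : ℝ) :
    IsCenteredNormal (fun ω => W t ω - W s ω) P :=
  isCenteredNormal_span hW.gaussian hW.measurable hW.mean_zero _
    (Submodule.sub_mem _ (Submodule.subset_span ⟨t, rfl⟩) (Submodule.subset_span ⟨s, rfl⟩))

lemma covariance_increments [IsProbabilityMeasure P] (hW : IsRegularFBM H ε W P)
    (t s a b : ℝ) :
    ∫ ω, (W t ω - W (t - a) ω) * (W s ω - W (s - b) ω) ∂P = sigmaHSq H / 2 *
      (|t - s + b| ^ (2 * H) + |t - s - a| ^ (2 * H) - |t - s| ^ (2 * H)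
        - |t - s - a + b| ^ (2 * H)) := by
  have hi : ∀ x y, Integrable (fun ω => W x ω * W y ω) P := fun x y =>
    (hW.isCenteredNormal x).integrable_mul (hW.isCenteredNormal y)
  have hexp : ∀ ω, (W t ω - W (t - a) ω) * (W s ω - W (s - b) ω) =
      W t ω * W s ω - W t ω * W (s - b) ω - W (t - a) ω * W s ω
        + W (t - a) ω * W (s - b) ω := fun ω => by ring
  have h1 : Integrable (fun ω => W t ω * W s ω - W t ω * W (s - b) ω) P :=
    (hi _ _).sub (hi _ _)
  have h2 : Integrable (fun ω => W t ω * W s ω - W t ω * W (s - b) ω - W (t - a) ω * W s ω) P :=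
    h1.sub (hi _ _)
  simp only [hexp]
  rw [integral_add h2 (hi _ _), integral_sub h1 (hi _ _), integral_sub (hi _ _) (hi _ _)]
  simp only [hW.covariance]
  rw [show t - (s - b) = t - s + b by ring, show t - a - s = t - s - a by ring,
    show t - a - (s - b) = t - s - a + b by ring]
  ring

lemma measurable_uncurry (hW : IsRegularFBM H ε W P) : Measurable (Function.uncurry W) :=
  measurable_uncurry_of_continuous_of_measurable hW.continuous hW.measurable

lemma integral_sq_increment [IsProbabilityMeasure P] (hW : IsRegularFBM H ε W P) (hH : 0 < H)
    (t a : ℝ) : ∫ ω, (W t ω - W (t - a) ω) ^ 2 ∂P = sigmaHSq H * |a| ^ (2 * H) := by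
  have h := hW.covariance_increments t t a a
  have h0 : (0 : ℝ) ^ (2 * H) = 0 := Real.zero_rpow (by positivity)
  simp only [sub_self, zero_add, zero_sub, abs_neg, neg_add_cancel, abs_zero, h0] at h
  simp only [sq, h]
  ring

/-- The covariance of the fractional Ornstein–Uhlenbeck process. -/
theorem covariance_fOU [IsProbabilityMeasure P] (hW : IsRegularFBM H ε W P) (hH : 0 < H)
    (hε : 0 < ε) (t s : ℝ) :
    ∫ ω, fOU H ε W t ω * fOU H ε W s ω ∂P = (ε ^ (-H)) ^ 2 * (sigmaHSq H / 2) *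
      ∫ q : ℝ × ℝ, (|t - s + ε * q.2| ^ (2 * H) + |t - s - ε * q.1| ^ (2 * H)
        - |t - s| ^ (2 * H) - |t - s - ε * q.1 + ε * q.2| ^ (2 * H)) ∂(expLaw.prod expLaw) := by
  have hmeas : ∀ r : ℝ, Measurable fun p : Ω × ℝ => W r p.1 - W (r - ε * p.2) p.1 := fun r =>
    ((hW.measurable r).comp measurable_fst).sub (hW.measurable_uncurry.comp
      (((measurable_const (a := r)).sub (measurable_snd.const_mul ε)).prodMk measurable_fst))
  have hjm : Measurable fun p : Ω × (ℝ × ℝ) => (W t p.1 - W (t - ε * p.2.1) p.1) *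
      (W s p.1 - W (s - ε * p.2.2) p.1) :=
    ((hmeas t).comp (measurable_fst.prodMk (measurable_fst.comp measurable_snd))).mul
      ((hmeas s).comp (measurable_fst.prodMk (measurable_snd.comp measurable_snd)))
  have hsq : ∀ r a, Integrable (fun ω => (W r ω - W (r - a) ω) ^ 2) P := fun r a => by
    have h := (hW.isCenteredNormal_sub r (r - a)).integrable_mul
      (hW.isCenteredNormal_sub r (r - a))
    simpa only [← sq] using h
  have hmul : ∀ a b, Integrable (fun ω => (W t ω - W (t - a) ω) * (W s ω - W (s - b) ω)) P :=
    fun a b => (hW.isCenteredNormal_sub t (t - a)).integrable_mul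
      (hW.isCenteredNormal_sub s (s - b))
  have hpow : Integrable (fun u : ℝ => |ε * u| ^ (2 * H)) expLaw := by
    have : ∀ u : ℝ, |ε * u| ^ (2 * H) = |ε| ^ (2 * H) * |u| ^ (2 * H) := fun u => by
      rw [abs_mul, Real.mul_rpow (abs_nonneg _) (abs_nonneg _)]
    simp only [this]
    exact (integrable_rpow_expLaw (by positivity)).const_mul _
  -- Fubini is justified by $|xy|\le x^2+y^2$: the second moments of the increments grow like
  -- $|\varepsilon u|^{2H}$, which the exponential law integrates.
  have hint : Integrable (fun p : Ω × (ℝ × ℝ) => (W t p.1 - W (t - ε * p.2.1) p.1) *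
      (W s p.1 - W (s - ε * p.2.2) p.1)) (P.prod (expLaw.prod expLaw)) := by
    rw [integrable_prod_iff' hjm.aestronglyMeasurable]
    refine ⟨ae_of_all _ fun q => hmul (ε * q.1) (ε * q.2), ?_⟩
    refine Integrable.mono' (g := fun q : ℝ × ℝ => sigmaHSq H * |ε * q.1| ^ (2 * H) +
      sigmaHSq H * |ε * q.2| ^ (2 * H)) ?_ ?_ (ae_of_all _ fun q => ?_)
    · exact ((hpow.const_mul _).comp_fst expLaw).add ((hpow.const_mul _).comp_snd expLaw)
    · exact (hjm.norm.stronglyMeasurable.integral_prod_left').aestronglyMeasurable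
    · rw [Real.norm_of_nonneg (integral_nonneg fun ω => norm_nonneg _),
        ← hW.integral_sq_increment hH t, ← hW.integral_sq_increment hH s,
        ← integral_add (hsq t (ε * q.1)) (hsq s (ε * q.2))]
      refine integral_mono (hmul (ε * q.1) (ε * q.2)).norm
        ((hsq t (ε * q.1)).add (hsq s (ε * q.2))) fun ω => ?_
      simp only [Real.norm_eq_abs]
      rw [abs_le]
      constructor <;>
        nlinarith [sq_nonneg (W t ω - W (t - ε * q.1) ω + (W s ω - W (s - ε * q.2) ω)),
          sq_nonneg (W t ω - W (t - ε * q.1) ω - (W s ω - W (s - ε * q.2) ω)),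
          sq_nonneg (W t ω - W (t - ε * q.1) ω), sq_nonneg (W s ω - W (s - ε * q.2) ω)]
  have hpt : ∀ ω, fOU H ε W t ω * fOU H ε W s ω = (ε ^ (-H)) ^ 2 *
      ∫ q : ℝ × ℝ, (W t ω - W (t - ε * q.1) ω) * (W s ω - W (s - ε * q.2) ω)
        ∂(expLaw.prod expLaw) := fun ω => by
    rw [hW.fOU_eq_integral hε, hW.fOU_eq_integral hε,
      integral_prod_mul (fun u => W t ω - W (t - ε * u) ω) (fun u => W s ω - W (s - ε * u) ω)]
    ring
  simp only [hpt]
  rw [integral_const_mul, integral_integral_swap hint, mul_assoc]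
  simp only [hW.covariance_increments]
  rw [integral_const_mul]

lemma sigmaHSq_nonneg (hH : 1 / 2 < H) (hH1 : H < 1) : 0 ≤ sigmaHSq H := by
  have h1 : 0 < Real.Gamma (2 * H + 1) := Real.Gamma_pos_of_pos (by linarith)
  have h2 : 0 < Real.sin (Real.pi * H) :=
    Real.sin_pos_of_pos_of_lt_pi (by positivity) (by nlinarith [Real.pi_pos])
  unfold sigmaHSq
  positivity

/-- Power law decay of the covariance of the fractional Ornstein–Uhlenbeck process. -/
theorem abs_covariance_fOU_le [IsProbabilityMeasure P] (hW : IsRegularFBM H ε W P)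
    (hH : 1 / 2 < H) (hH1 : H < 1) (hε : 0 < ε) {t s : ℝ} (hts : s < t) :
    |∫ ω, fOU H ε W t ω * fOU H ε W s ω ∂P| ≤
      2 * H * sigmaHSq H * ε ^ (2 - 2 * H) * (t - s) ^ (2 * H - 2) := by
  have hσ := sigmaHSq_nonneg hH hH1
  rw [hW.covariance_fOU (by linarith) hε, abs_mul, abs_of_nonneg (by positivity)]
  have hi : Integrable (fun q : ℝ × ℝ => q.1 ^ 2 + q.2 ^ 2) (expLaw.prod expLaw) :=
    (integrable_sq_expLaw.comp_fst expLaw).add (integrable_sq_expLaw.comp_snd expLaw)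
  have hpos : ∀ᵐ q : ℝ × ℝ ∂(expLaw.prod expLaw), 0 < q.1 ∧ 0 < q.2 :=
    (Measure.quasiMeasurePreserving_fst.ae ae_expLaw_pos).and
      (Measure.quasiMeasurePreserving_snd.ae ae_expLaw_pos)
  have hb := norm_integral_le_of_norm_le (hi.const_mul (H * (t - s) ^ (2 * H - 2) * ε ^ 2))
    (f := fun q : ℝ × ℝ => |t - s + ε * q.2| ^ (2 * H) + |t - s - ε * q.1| ^ (2 * H)
        - |t - s| ^ (2 * H) - |t - s - ε * q.1 + ε * q.2| ^ (2 * H)) (by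
      filter_upwards [hpos] with q hq
      refine (abs_mixed_difference_le hH.le hH1.le (sub_pos.2 hts)
        (mul_nonneg hε.le hq.1.le) (mul_nonneg hε.le hq.2.le)).trans_eq ?_
      ring)
  have h4 : ∫ q : ℝ × ℝ, (q.1 ^ 2 + q.2 ^ 2) ∂(expLaw.prod expLaw) = 4 := by
    rw [integral_add (integrable_sq_expLaw.comp_fst expLaw)
      (integrable_sq_expLaw.comp_snd expLaw), integral_fun_fst (fun u : ℝ => u ^ 2),
      integral_fun_snd (fun u : ℝ => u ^ 2), integral_sq_expLaw]
    simp
    norm_num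
  rw [integral_const_mul, h4, Real.norm_eq_abs] at hb
  refine (mul_le_mul_of_nonneg_left hb (by positivity)).trans_eq ?_
  have he : ε ^ (2 - 2 * H) = (ε ^ (-H)) ^ 2 * ε ^ 2 := by
    rw [← Real.rpow_natCast, ← Real.rpow_mul hε.le, ← Real.rpow_natCast ε 2,
      ← Real.rpow_add hε]
    congr 1
    push_cast
    ring
  rw [he]
  ring

/-- The stationary variance of the fractional Ornstein–Uhlenbeck process. -/
theorem variance_fOU [IsProbabilityMeasure P] (hW : IsRegularFBM H ε W P) (hH : 0 < H)
    (hε : 0 < ε) (t : ℝ) :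
    ∫ ω, fOU H ε W t ω ^ 2 ∂P = Real.Gamma (2 * H + 1) * sigmaHSq H / 2 := by
  have h2H : 0 < 2 * H := by positivity
  have hsimp : ∀ q : ℝ × ℝ, |0 + ε * q.2| ^ (2 * H) + |0 - ε * q.1| ^ (2 * H)
      - |(0 : ℝ)| ^ (2 * H) - |0 - ε * q.1 + ε * q.2| ^ (2 * H) = ε ^ (2 * H) *
      (|q.2| ^ (2 * H) + |q.1| ^ (2 * H) - |q.2 - q.1| ^ (2 * H)) := fun q => by
    rw [show 0 - ε * q.1 + ε * q.2 = ε * (q.2 - q.1) by ring, zero_add, zero_sub, abs_neg,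
      abs_mul, abs_mul, abs_mul, abs_of_pos hε, Real.mul_rpow hε.le (abs_nonneg _),
      Real.mul_rpow hε.le (abs_nonneg _), Real.mul_rpow hε.le (abs_nonneg _), abs_zero,
      Real.zero_rpow h2H.ne']
    ring
  have hp := integrable_rpow_expLaw h2H.le
  have hc : (ε ^ (-H)) ^ 2 * ε ^ (2 * H) = 1 := by
    rw [← Real.rpow_natCast, ← Real.rpow_mul hε.le, ← Real.rpow_add hε]
    norm_num
    rw [show -(H * 2) + 2 * H = 0 by ring, Real.rpow_zero]
  have h := hW.covariance_fOU hH hε t t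
  simp only [sub_self, hsimp] at h
  have hadd : Integrable (fun q : ℝ × ℝ => |q.2| ^ (2 * H) + |q.1| ^ (2 * H))
      (expLaw.prod expLaw) := (hp.comp_snd expLaw).add (hp.comp_fst expLaw)
  -- All three terms equal $\Gamma(2H+1)$, the last because the difference of two exponentials has
  -- the same absolute moments. The bracket is thus $1+1-1$ times that value.
  rw [integral_const_mul, integral_sub hadd
    (integrable_abs_sub_rpow h2H), integral_add (hp.comp_snd expLaw) (hp.comp_fst expLaw),
    integral_fun_snd (fun u : ℝ => |u| ^ (2 * H)), integral_fun_fst (fun u : ℝ => |u| ^ (2 * H)),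
    integral_abs_sub_rpow h2H, integral_rpow_expLaw h2H.le] at h
  simp only [probReal_univ, one_smul, add_sub_cancel_right] at h
  simp only [sq, h]
  linear_combination (sigmaHSq H / 2 * Real.Gamma (2 * H + 1)) * hc

lemma map_fOU [IsProbabilityMeasure P] (hW : IsRegularFBM H ε W P)
    (hH : 1 / 2 < H) (hH1 : H < 1) (hε : 0 < ε) (t : ℝ) :
    P.map (fOU H ε W t) = (gaussianReal 0 1).map fun z => sigmaOU H * z := by
  have h0 : 0 < H := by linarith
  have hσ := sigmaHSq_nonneg hH hH1
  have hΓ : 0 ≤ Real.Gamma (2 * H + 1) := Real.Gamma_nonneg_of_nonneg (by positivity)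
  rw [(hW.isCenteredNormal_fOU t).map_eq, hW.variance_fOU h0 hε,
    gaussianReal_eq_map_std (by positivity)]
  rfl

lemma integral_sq_fOU [IsProbabilityMeasure P] (hW : IsRegularFBM H ε W P)
    (hH : 1 / 2 < H) (hH1 : H < 1) (hε : 0 < ε) {F : ℝ → ℝ} (hF : Continuous F) (t : ℝ) :
    ∫ ω, F (fOU H ε W t ω) ^ 2 ∂P = meanSq H F := by
  rw [← integral_map (φ := fOU H ε W t) (f := fun x => F x ^ 2)
    (hW.isCenteredNormal_fOU t).1.aemeasurable (by fun_prop), hW.map_fOU hH hH1 hε,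
    integral_map (by fun_prop) (by fun_prop), meanSq]

end IsRegularFBM

/-! ### Passing to a version that is regular on every path. -/

section Regularization

open Filter Topology

variable {Ω : Type*} [MeasurableSpace Ω] {H ε : ℝ} {W W' : ℝ → Ω → ℝ} {P : Measure Ω}

lemma IsFBM.congr (hW : IsFBM H W P) (h : ∀ᵐ ω ∂P, ∀ t, W' t ω = W t ω) : IsFBM H W' P where
  gaussian := hW.gaussian.congr fun t => by filter_upwards [h] with ω hω using (hω t).symm
  mean_zero t := by
    rw [← hW.mean_zero t]
    exact integral_congr_ae (by filter_upwards [h] with ω hω using hω t)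
  covariance t s := by
    rw [← hW.covariance t s]
    exact integral_congr_ae (by filter_upwards [h] with ω hω; rw [hω t, hω s])
  continuous_paths := by
    filter_upwards [h, hW.continuous_paths] with ω hω hc
    simpa only [hω] using hc

lemma measurable_of_forall_rat {W : ℝ → Ω → ℝ} (hc : ∀ ω, Continuous fun t => W t ω)
    (hm : ∀ q : ℚ, Measurable (W q)) (t : ℝ) : Measurable (W t) := by
  obtain ⟨u, hu, hlim⟩ := mem_closure_iff_seq_limit.1 (Rat.denseRange_cast (𝕜 := ℝ) t)
  refine measurable_of_tendsto_metrizable (f := fun n => W (u n)) (fun n => ?_)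
    (tendsto_pi_nhds.2 fun ω => ((hc ω).tendsto t).comp hlim)
  obtain ⟨q, hq⟩ := hu n
  rw [← hq]
  exact hm q

/-- A fractional Brownian motion has a version with continuous paths and measurable marginals,
indistinguishable from it. -/
lemma IsFBM.exists_continuous_version (hW : IsFBM H W P) :
    ∃ W' : ℝ → Ω → ℝ, IsFBM H W' P ∧ (∀ t, Measurable (W' t)) ∧
      (∀ ω, Continuous fun t => W' t ω) ∧ ∀ᵐ ω ∂P, ∀ t, W' t ω = W t ω := by
  classical
  -- The marginals are only a.e. measurable. Rational times cost one null set, and continuity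
  -- extends measurability to all times.
  have hae : ∀ᵐ ω ∂P, (∀ q : ℚ, W q ω = (hW.gaussian.aemeasurable (q : ℝ)).mk _ ω) ∧
      Continuous fun t => W t ω :=
    (ae_all_iff.2 fun q : ℚ => (hW.gaussian.aemeasurable (q : ℝ)).ae_eq_mk).and
      hW.continuous_paths
  obtain ⟨A, hA, hAm, hAp⟩ := hae.exists_measurable_mem
  have heq : ∀ᵐ ω ∂P, ∀ t, A.indicator (W t) ω = W t ω := by
    filter_upwards [hA] with ω hω t using Set.indicator_of_mem hω _
  have hc : ∀ ω, Continuous fun t => A.indicator (W t) ω := fun ω => by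
    by_cases hω : ω ∈ A
    · simpa only [Set.indicator_of_mem hω] using (hAp ω hω).2
    · simpa only [Set.indicator_of_notMem hω] using continuous_const
  refine ⟨fun t => A.indicator (W t), hW.congr heq, measurable_of_forall_rat hc fun q => ?_,
    hc, heq⟩
  have : A.indicator (W q) = A.indicator ((hW.gaussian.aemeasurable (q : ℝ)).mk _) :=
    Set.indicator_congr fun ω hω => (hAp ω hω).1 q
  rw [this]
  exact (hW.gaussian.aemeasurable (q : ℝ)).measurable_mk.indicator hAm

lemma IsFBM.integral_sq (hW : IsFBM H W P) (hH : 0 < H) (s : ℝ) :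
    ∫ ω, W s ω ^ 2 ∂P = sigmaHSq H * |s| ^ (2 * H) := by
  have h := hW.covariance s s
  rw [sub_self, abs_zero, Real.zero_rpow (by positivity)] at h
  simp only [sq, h]
  ring

/-- Fubini again: $E|W_s|\le1+E W_s^2$ grows polynomially, so the exponential weight makes the joint
integral finite. -/
lemma IsFBM.ae_integrableOn [IsProbabilityMeasure P] (hW : IsFBM H W P) (hH : 0 < H)
    (hε : 0 < ε) (hm : ∀ t, Measurable (W t)) (hc : ∀ ω, Continuous fun t => W t ω) :
    ∀ᵐ ω ∂P, IntegrableOn (fun s => Real.exp (s / ε) * W s ω) (Set.Iic 0) := by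
  have hjm : Measurable fun p : Ω × ℝ => Real.exp (p.2 / ε) * W p.2 p.1 := by
    have := (measurable_uncurry_of_continuous_of_measurable hc hm).comp
      (measurable_snd.prodMk measurable_fst : Measurable fun p : Ω × ℝ => (p.2, p.1))
    exact Measurable.mul (by fun_prop) this
  have hL2 : ∀ s, MemLp (W s) 2 P := fun s => (hW.gaussian.hasGaussianLaw_eval s).memLp_two
  have hbound : IntegrableOn (fun s : ℝ => Real.exp (s / ε) *
      (1 + sigmaHSq H * |s| ^ (2 * H))) (Set.Iic 0) := by
    have h := (integrable_expLaw_iff_integrableOn_Iic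
      (fun s : ℝ => 1 + sigmaHSq H * |s| ^ (2 * H)) 0 hε).1 ?_
    · simpa using h
    · have : ∀ u : ℝ, |0 - ε * u| ^ (2 * H) = |ε| ^ (2 * H) * |u| ^ (2 * H) := fun u => by
        rw [zero_sub, abs_neg, abs_mul, Real.mul_rpow (abs_nonneg _) (abs_nonneg _)]
      simp only [this]
      exact (integrable_const _).add
        (((integrable_rpow_expLaw (by positivity)).const_mul _).const_mul _)
  have hint : Integrable (fun p : Ω × ℝ => Real.exp (p.2 / ε) * W p.2 p.1)
      (P.prod (volume.restrict (Set.Iic 0))) := by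
    rw [integrable_prod_iff' hjm.aestronglyMeasurable]
    refine ⟨ae_of_all _ fun s =>
      ((hL2 s).integrable one_le_two).const_mul (Real.exp (s / ε)), ?_⟩
    refine hbound.mono' (hjm.norm.stronglyMeasurable.integral_prod_left').aestronglyMeasurable
      (ae_of_all _ fun s => ?_)
    rw [Real.norm_of_nonneg (integral_nonneg fun ω => norm_nonneg _)]
    simp only [norm_mul, Real.norm_eq_abs, Real.abs_exp]
    rw [integral_const_mul]
    gcongr
    have h1 : ∫ ω, (1 + W s ω ^ 2) ∂P = 1 + sigmaHSq H * |s| ^ (2 * H) := by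
      rw [integral_add (integrable_const _) (hL2 s).integrable_sq, hW.integral_sq hH]
      simp
    rw [← h1]
    refine integral_mono ((hL2 s).integrable one_le_two).abs
      ((integrable_const _).add (hL2 s).integrable_sq) fun ω => ?_
    simp only
    rw [abs_le]
    constructor <;> nlinarith [sq_nonneg (W s ω - 1), sq_nonneg (W s ω + 1)]
  exact hint.prod_right_ae

/-- A fractional Brownian motion is indistinguishable from a regular one. -/
theorem IsFBM.exists_isRegularFBM [IsProbabilityMeasure P] (hW : IsFBM H W P) (hH : 0 < H)
    (hε : 0 < ε) :
    ∃ W' : ℝ → Ω → ℝ, IsRegularFBM H ε W' P ∧ ∀ᵐ ω ∂P, ∀ t, W' t ω = W t ω := by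
  classical
  obtain ⟨V, hV, hVm, hVc, hVW⟩ := hW.exists_continuous_version
  obtain ⟨A, hA, hAm, hAp⟩ := (hV.ae_integrableOn hH hε hVm hVc).exists_measurable_mem
  have heq : ∀ᵐ ω ∂P, ∀ t, A.indicator (V t) ω = V t ω := by
    filter_upwards [hA] with ω hω t using Set.indicator_of_mem hω _
  have h := hV.congr heq
  refine ⟨fun t => A.indicator (V t), ⟨h.gaussian, h.mean_zero, h.covariance,
    fun t => (hVm t).indicator hAm, fun ω => ?_, fun ω => ?_⟩, ?_⟩
  · by_cases hω : ω ∈ A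
    · simpa only [Set.indicator_of_mem hω] using hVc ω
    · simpa only [Set.indicator_of_notMem hω] using continuous_const
  · by_cases hω : ω ∈ A
    · simpa only [Set.indicator_of_mem hω] using hAp ω hω
    · simp [Set.indicator_of_notMem hω]
  · filter_upwards [heq, hVW] with ω h1 h2 t
    rw [h1, h2]

end Regularization

/-! ### Summing the covariances and passing to the limit. -/

section FourthMoment

open Filter Topology

/-- Each new index adds one diagonal entry and two equal off-diagonal strips, each bounded by the
sum of `b`. The fixed cutoff `N` keeps that bound constant in the induction; `b k` belongs to the
gap $k+1$. -/
lemma sum_sum_range_le {C : ℕ → ℕ → ℝ} (hsymm : ∀ i j, C i j = C j i) {V : ℝ}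
    (hd : ∀ i, C i i ≤ V) {b : ℕ → ℝ} (hb0 : ∀ k, 0 ≤ b k)
    (hb : ∀ i j, j < i → C i j ≤ b (i - 1 - j)) {n N : ℕ} (hn : n ≤ N) :
    ∑ i ∈ Finset.range n, ∑ j ∈ Finset.range n, C i j ≤
      n * (V + 2 * ∑ k ∈ Finset.range N, b k) := by
  induction n with
  | zero => simp
  | succ n ih =>
    have hrow : ∑ j ∈ Finset.range n, C n j ≤ ∑ k ∈ Finset.range N, b k :=
      calc ∑ j ∈ Finset.range n, C n j ≤ ∑ j ∈ Finset.range n, b (n - 1 - j) :=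
            Finset.sum_le_sum fun j hj => hb n j (Finset.mem_range.1 hj)
        _ = ∑ k ∈ Finset.range n, b k := Finset.sum_range_reflect b n
        _ ≤ ∑ k ∈ Finset.range N, b k :=
            Finset.sum_le_sum_of_subset_of_nonneg (Finset.range_mono (by omega))
              fun k _ _ => hb0 k
    have hcol : ∑ i ∈ Finset.range n, C i n = ∑ j ∈ Finset.range n, C n j :=
      Finset.sum_congr rfl fun i _ => hsymm i n
    rw [Finset.sum_range_succ]
    simp only [Finset.sum_range_succ _ n, Finset.sum_add_distrib]
    rw [hcol]
    have := ih (by omega)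
    push_cast
    linarith [hd n]

variable {Ω : Type*} [MeasurableSpace Ω] {H ε : ℝ} {W : ℝ → Ω → ℝ} {P : Measure Ω}

namespace IsRegularFBM

lemma sum_abs_covariance_le [IsProbabilityMeasure P] (hW : IsRegularFBM H ε W P)
    (hH : 1 / 2 < H) (hH1 : H < 1) (hε : 0 < ε) {t : ℝ} (ht : 0 < t) {n : ℕ} (hn : 0 < n) :
    ∑ i ∈ Finset.range n, ∑ j ∈ Finset.range n, (t / n) ^ 2 *
      |∫ ω, fOU H ε W (t * (i / n)) ω * fOU H ε W (t * (j / n)) ω ∂P| ≤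
    t ^ 2 * (Real.Gamma (2 * H + 1) * sigmaHSq H / 2) * (1 / n) +
      4 * H * sigmaHSq H / (2 * H - 1) * t ^ (2 * H) * ε ^ (2 - 2 * H) := by
  have hn0 : (0 : ℝ) < n := by exact_mod_cast hn
  have hσ := sigmaHSq_nonneg hH hH1
  have hH0 : 0 < H := by linarith
  set A : ℝ := 2 * H * sigmaHSq H * ε ^ (2 - 2 * H) with hA
  set V : ℝ := Real.Gamma (2 * H + 1) * sigmaHSq H / 2 with hV
  have hA0 : 0 ≤ A := by positivity
  set w : ℝ := t / n with hw
  have hw0 : 0 < w := by positivity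
  have hC := sum_sum_range_le
    (C := fun i j => |∫ ω, fOU H ε W (t * (i / n)) ω * fOU H ε W (t * (j / n)) ω ∂P|)
    (V := V) (b := fun k : ℕ => A * (w * ((k : ℝ) + 1)) ^ (2 * H - 2))
    (fun i j => by simp only [mul_comm]) (fun i => by
      simp only [← sq]
      rw [abs_of_nonneg (integral_nonneg fun ω => sq_nonneg _), hW.variance_fOU hH0 hε])
    (fun k => by positivity) (fun i j hij => by
      have h1 : t * ((j : ℝ) / n) < t * ((i : ℝ) / n) := by
        have : (j : ℝ) < i := by exact_mod_cast hij
        gcongr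
      refine (hW.abs_covariance_fOU_le hH hH1 hε h1).trans_eq ?_
      have h2 : ((i - 1 - j : ℕ) : ℝ) + 1 = i - j := by
        have h3 : i - 1 - j + 1 + j = i := by omega
        have h4 : ((i - 1 - j + 1 + j : ℕ) : ℝ) = i := by rw [h3]
        push_cast at h4
        linarith
      rw [h2]
      congr 2
      rw [hw]
      ring) (le_refl n)
  simp only [← Finset.mul_sum]
  have hsum : ∑ k ∈ Finset.range n, A * (w * ((k : ℝ) + 1)) ^ (2 * H - 2) ≤
      A * (w ^ (2 * H - 2) * ((n : ℝ) ^ (2 * H - 1) / (2 * H - 1))) := by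
    have h := sum_rpow_le (a := 2 * H - 1) (by linarith) (by linarith) n
    rw [show 2 * H - 1 - 1 = 2 * H - 2 by ring] at h
    rw [← Finset.mul_sum]
    refine mul_le_mul_of_nonneg_left ?_ hA0
    refine le_trans (le_of_eq ?_) (mul_le_mul_of_nonneg_left h (by positivity))
    rw [Finset.mul_sum]
    exact Finset.sum_congr rfl fun k _ => Real.mul_rpow hw0.le (by positivity)
  -- With $t=wn$ all mesh powers in the off-diagonal part combine, so that part is bounded uniformly
  -- in $n$.
  have hpow : t ^ (2 * H) = w ^ 2 * n * (w ^ (2 * H - 2) * (n : ℝ) ^ (2 * H - 1)) := by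
    have e1 : w ^ (2 * H) = w ^ (2 * H - 2) * w ^ 2 := by
      rw [← Real.rpow_two, ← Real.rpow_add hw0]; congr 1; ring
    have e2 : (n : ℝ) ^ (2 * H) = (n : ℝ) ^ (2 * H - 1) * n := by
      rw [← Real.rpow_add_one hn0.ne']; congr 1; ring
    rw [show t = w * n by rw [hw]; field_simp, Real.mul_rpow hw0.le hn0.le, e1, e2]
    ring
  calc w ^ 2 * ∑ i ∈ Finset.range n, ∑ j ∈ Finset.range n,
        |∫ ω, fOU H ε W (t * (i / n)) ω * fOU H ε W (t * (j / n)) ω ∂P|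
      ≤ w ^ 2 * (n * (V + 2 * (A * (w ^ (2 * H - 2) *
          ((n : ℝ) ^ (2 * H - 1) / (2 * H - 1)))))) := by
        refine mul_le_mul_of_nonneg_left (hC.trans ?_) (by positivity)
        gcongr
    _ = t ^ 2 * V * (1 / n) +
        4 * H * sigmaHSq H / (2 * H - 1) * t ^ (2 * H) * ε ^ (2 - 2 * H) := by
        rw [hpow, hA]
        have h1 : t ^ 2 * V * (1 / n) = w ^ 2 * n * V := by
          rw [hw]; field_simp
        rw [h1]
        ring

variable {F : ℝ → ℝ}

lemma tendsto_fluctuation (hW : IsRegularFBM H ε W P) (hF : Continuous F) (t : ℝ) (ω : Ω) :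
    Tendsto (fun n : ℕ => ∑ i : Fin n, t / n *
      (F (fOU H ε W (t * ((i : ℕ) / n)) ω) ^ 2 - meanSq H F)) atTop
      (𝓝 (fluctuation H ε F W t ω)) := by
  have hc := hW.continuous_fOU ω
  have h := tendsto_riemannSum
    (by fun_prop : Continuous fun s => F (fOU H ε W s ω) ^ 2 - meanSq H F) 0 t
  simp only [sub_zero, zero_add] at h
  refine h.congr fun n => ?_
  rw [Finset.sum_range]

/-- The fourth moment bound for the fluctuation process of a regular fractional Brownian motion. -/
theorem integral_fluctuation_pow_four_le [IsProbabilityMeasure P] (hW : IsRegularFBM H ε W P)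
    (hH : 1 / 2 < H) (hH1 : H < 1) (hε : 0 < ε) (hF : ContDiff ℝ 1 F) {M₀ M₁ : ℝ}
    (hM₀ : ∀ x, |F x| ≤ M₀) (hM₁ : ∀ x, |deriv F x| ≤ M₁) {t : ℝ} (ht : 0 < t) :
    Integrable (fun ω => fluctuation H ε F W t ω ^ 4) P ∧
    ∫ ω, fluctuation H ε F W t ω ^ 4 ∂P ≤ (Real.pi / 2) ^ 4 * (((2 * M₀ * M₁) ^ 2 *
      (4 * H * sigmaHSq H / (2 * H - 1) * t ^ (2 * H) * ε ^ (2 - 2 * H))) ^ 2 *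
        gaussianFourthMoment) := by
  have hFc : Continuous F := hF.continuous
  have hF'c : Continuous (deriv F) := hF.continuous_deriv le_rfl
  have hM₀0 : 0 ≤ M₀ := (abs_nonneg _).trans (hM₀ 0)
  have hσ := sigmaHSq_nonneg hH hH1
  have hZm : ∀ s, Measurable (fOU H ε W s) := fun s => (hW.isCenteredNormal_fOU s).1
  set g : ℝ → ℝ := fun x => F x ^ 2 - meanSq H F with hg
  set B : ℝ := M₀ ^ 2 + |meanSq H F| with hB
  have hgB : ∀ x, |g x| ≤ B := fun x => by
    refine (norm_sub_le (F x ^ 2) (meanSq H F)).trans (add_le_add_left ?_ _)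
    rw [norm_pow, Real.norm_eq_abs]
    exact pow_le_pow_left₀ (abs_nonneg _) (hM₀ x) 2
  have hg' : ∀ x, HasDerivAt g (2 * F x * deriv F x) x := fun x => by
    have h := ((hF.differentiable one_ne_zero x).hasDerivAt.fun_pow 2).sub_const (meanSq H F)
    simpa [hg] using h
  have hgM : ∀ x, |2 * F x * deriv F x| ≤ 2 * M₀ * M₁ := fun x => by
    rw [abs_mul, abs_mul, abs_two]
    gcongr
    · exact hM₀ x
    · exact hM₁ x
  have hgc : Continuous g := by fun_prop
  have hg0 : ∀ s, ∫ ω, g (fOU H ε W s ω) ∂P = 0 := fun s => by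
    have hi : Integrable (fun ω => F (fOU H ε W s ω) ^ 2) P :=
      Integrable.of_bound (by have := hZm s; fun_prop) (M₀ ^ 2) (ae_of_all _ fun ω => by
        rw [norm_pow, Real.norm_eq_abs]
        exact pow_le_pow_left₀ (abs_nonneg _) (hM₀ _) 2)
    simp only [hg]
    rw [integral_sub hi (integrable_const _), hW.integral_sq_fOU hH hH1 hε hFc]
    simp
  set I : ℕ → Ω → ℝ := fun n ω => ∑ i : Fin n, t / n * g (fOU H ε W (t * ((i : ℕ) / n)) ω)
    with hI
  have hIm : ∀ n, Measurable (I n) := fun n =>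
    Finset.measurable_sum _ fun i _ => (hgc.measurable.comp (hZm _)).const_mul _
  have hIlim : ∀ ω, Tendsto (fun n => I n ω) atTop (𝓝 (fluctuation H ε F W t ω)) :=
    fun ω => hW.tendsto_fluctuation hFc t ω
  have hIB : ∀ n ω, |I n ω| ≤ t * B := fun n ω => by
    have hB0 : 0 ≤ B := by positivity
    rcases Nat.eq_zero_or_pos n with rfl | hn
    · simp only [hI, Finset.univ_eq_empty, Finset.sum_empty, abs_zero]
      positivity
    · have hn0 : (0 : ℝ) < n := by exact_mod_cast hn
      calc |I n ω| ≤ ∑ _i : Fin n, t / n * B := by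
            refine (Finset.abs_sum_le_sum_abs _ _).trans (Finset.sum_le_sum fun i _ => ?_)
            rw [abs_mul, abs_of_nonneg (by positivity)]
            exact mul_le_mul_of_nonneg_left (hgB _) (by positivity)
        _ = t * B := by
            rw [Finset.sum_const, Finset.card_univ, Fintype.card_fin, nsmul_eq_mul]
            field_simp
  have hfm : Measurable (fluctuation H ε F W t) :=
    measurable_of_tendsto_metrizable hIm (tendsto_pi_nhds.2 hIlim)
  have hpow4 : ∀ x : ℝ, |x| ≤ t * B → ‖x ^ 4‖ ≤ (t * B) ^ 4 := fun x hx => by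
    rw [norm_pow, Real.norm_eq_abs]
    exact pow_le_pow_left₀ (abs_nonneg _) hx 4
  refine ⟨Integrable.of_bound (by fun_prop) ((t * B) ^ 4) (ae_of_all _ fun ω => hpow4 _
    (le_of_tendsto' (hIlim ω).abs fun n => hIB n ω)), ?_⟩
  have hlim : Tendsto (fun n => ∫ ω, I n ω ^ 4 ∂P) atTop
      (𝓝 (∫ ω, fluctuation H ε F W t ω ^ 4 ∂P)) :=
    tendsto_integral_of_dominated_convergence (fun _ => (t * B) ^ 4)
      (fun n => by have := hIm n; fun_prop) (integrable_const _)
      (fun n => ae_of_all _ fun ω => hpow4 _ (hIB n ω))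
      (ae_of_all _ fun ω => (hIlim ω).pow 4)
  set R : ℝ := 4 * H * sigmaHSq H / (2 * H - 1) * t ^ (2 * H) * ε ^ (2 - 2 * H) with hR
  set V : ℝ := t ^ 2 * (Real.Gamma (2 * H + 1) * sigmaHSq H / 2) with hV
  have hbound : ∀ n : ℕ, 0 < n → ∫ ω, I n ω ^ 4 ∂P ≤ (Real.pi / 2) ^ 4 *
      (((2 * M₀ * M₁) ^ 2 * (V * (1 / n) + R)) ^ 2 * gaussianFourthMoment) := fun n hn => by
    refine (integral_sum_pow_four_le hW.isCenteredNormal_of_mem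
      (Z := fun i : Fin n => fOU H ε W (t * ((i : ℕ) / n))) (fun i => hW.fOU_mem _) hg'
      (by fun_prop) hgM hgB (fun i => hg0 _) (w := t / n) (by positivity)).trans ?_
    have hS := hW.sum_abs_covariance_le hH hH1 hε ht hn
    simp only [Finset.sum_range] at hS
    have := gaussianFourthMoment_nonneg
    gcongr
  -- The diagonal contribution $V/n$ carries no power of $\varepsilon$; it disappears in the limit
  -- for each fixed $\varepsilon$, leaving `R`.
  have hRlim : Tendsto (fun n : ℕ => (Real.pi / 2) ^ 4 * (((2 * M₀ * M₁) ^ 2 *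
      (V * (1 / (n : ℝ)) + R)) ^ 2 * gaussianFourthMoment)) atTop
      (𝓝 ((Real.pi / 2) ^ 4 * (((2 * M₀ * M₁) ^ 2 * (V * 0 + R)) ^ 2 *
        gaussianFourthMoment))) :=
    (((((tendsto_one_div_atTop_nhds_zero_nat (𝕜 := ℝ)).const_mul V).add_const R).const_mul
      _).pow 2 |>.mul_const _).const_mul _
  rw [mul_zero, zero_add] at hRlim
  exact le_of_tendsto_of_tendsto hlim hRlim
    ((eventually_gt_atTop 0).mono fun n hn => hbound n hn)

end IsRegularFBM

omit [MeasurableSpace Ω] in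
lemma fOU_congr {W' : ℝ → Ω → ℝ} {ω : Ω} (h : ∀ t, W' t ω = W t ω) (t : ℝ) :
    fOU H ε W' t ω = fOU H ε W t ω := by
  simp only [fOU, h]

end FourthMoment

end FracOU

theorem lemmaA1 (H : ℝ) (hH : 1 / 2 < H) (hH1 : H < 1)
    (F : ℝ → ℝ) (hF : ContDiff ℝ ((⊤ : ℕ∞) : WithTop ℕ∞) F)
    (hFb : ∀ n : ℕ, ∃ M : ℝ, ∀ x : ℝ, |iteratedDeriv n F x| ≤ M)
    (hC : ∃ α : ℝ, 2 < α ∧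
      Summable fun k : ℕ => α ^ k * FracOU.hermiteCoeff H F k ^ 2 / (k.factorial : ℝ))
    (T : ℝ) (hT : 0 < T) :
    ∃ K : ℝ, ∀ (Ω : Type*) [MeasurableSpace Ω] (P : Measure Ω) [IsProbabilityMeasure P]
      (W : ℝ → Ω → ℝ), FracOU.IsFBM H W P → ∀ ε : ℝ, 0 < ε →
        (∀ᵐ ω ∂P, ∀ t : ℝ,
          IntegrableOn (fun s => Real.exp (-(t - s) / ε) * W s ω) (Set.Iic t)) ∧
        (∀ᵐ ω ∂P, IntervalIntegrable
          (fun s => F (FracOU.fOU H ε W s ω) ^ 2 - FracOU.meanSq H F) volume 0 T) ∧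
        ∀ t ∈ Set.Icc 0 T,
          Integrable (fun ω => FracOU.fluctuation H ε F W t ω ^ 4) P ∧
          ∫ ω, FracOU.fluctuation H ε F W t ω ^ 4 ∂P ≤ K * ε ^ (4 - 4 * H) := by
  obtain ⟨M₀, hM₀⟩ := hFb 0
  obtain ⟨M₁, hM₁⟩ := hFb 1
  simp only [iteratedDeriv_zero, iteratedDeriv_one] at hM₀ hM₁
  have hσ := FracOU.IsRegularFBM.sigmaHSq_nonneg hH hH1
  have hm4 := FracOU.gaussianFourthMoment_nonneg
  have h2H : 0 < 2 * H - 1 := by linarith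
  have hH0 : 0 < H := by linarith
  have hFc : Continuous F := hF.continuous
  -- The bound at time $T$ with $\varepsilon^{2-2H}$ removed; $F$ enters only through bounds on
  -- $|F|$ and $|F'|$.
  refine ⟨(Real.pi / 2) ^ 4 * (((2 * M₀ * M₁) ^ 2 * (4 * H * FracOU.sigmaHSq H / (2 * H - 1) *
    T ^ (2 * H))) ^ 2 * FracOU.gaussianFourthMoment), ?_⟩
  intro Ω _ P _ W hW ε hε
  obtain ⟨W', hW', heq⟩ := hW.exists_isRegularFBM hH0 hε
  refine ⟨?_, ?_, fun t ht => ?_⟩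
  · filter_upwards [heq] with ω hω t
    simp only [← hω]
    exact FracOU.IsRegularFBM.integrableOn_kernel (hW'.continuous ω) (hW'.integrableOn ω) t
  · filter_upwards [heq] with ω hω
    simp only [← FracOU.fOU_congr hω]
    have := hW'.continuous_fOU ω
    exact (by fun_prop : Continuous fun s =>
      F (FracOU.fOU H ε W' s ω) ^ 2 - FracOU.meanSq H F).intervalIntegrable _ _
  · have hfl : (fun ω => FracOU.fluctuation H ε F W' t ω ^ 4) =ᵐ[P]
        fun ω => FracOU.fluctuation H ε F W t ω ^ 4 := by
      filter_upwards [heq] with ω hω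
      simp only [FracOU.fluctuation, FracOU.fOU_congr hω]
    -- Time $0$ is separate because the grid estimate needs a positive step.
    rcases ht.1.eq_or_lt with rfl | ht0
    · simp only [FracOU.fluctuation, intervalIntegral.integral_same]
      refine ⟨by simp, ?_⟩
      simp only [ne_eq, OfNat.ofNat_ne_zero, not_false_eq_true, zero_pow, integral_zero]
      positivity
    · obtain ⟨h1, h2⟩ := hW'.integral_fluctuation_pow_four_le hH hH1 hε
        (hF.of_le (by exact_mod_cast le_top)) hM₀ hM₁ ht0
      refine ⟨h1.congr hfl, ?_⟩
      rw [← integral_congr_ae hfl]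
      refine h2.trans ?_
      have he : ε ^ (4 - 4 * H) = (ε ^ (2 - 2 * H)) ^ 2 := by
        rw [← Real.rpow_natCast, ← Real.rpow_mul hε.le]
        congr 1
        push_cast
        ring
      calc _ ≤ (Real.pi / 2) ^ 4 * (((2 * M₀ * M₁) ^ 2 * (4 * H * FracOU.sigmaHSq H /
              (2 * H - 1) * T ^ (2 * H) * ε ^ (2 - 2 * H))) ^ 2 *
              FracOU.gaussianFourthMoment) := by
            gcongr
            exact ht.2
        _ = _ := by
            rw [he]
            ring
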